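/- **Setting.** A network is a finite connected simple graph $G=(V,E)$ with $n=|V|$ nodes that is not bipartite. Nodes are anonymous, each knows $n$, the number $\tau=\tau(G,n)$ defined below, its own degree, and a numbering of its incident edges (ports), which is arbitrary. Computation proceeds in synchronous rounds $0,1,2,\dots$: in each round every node may send at most one message through each of its ports, receives the messages sent to it in that round, and updates its state. All nodes run the same program and have independent private randomness. In the CONGEST model messages have $O(\log n)$ bits. Every node has a status in $\{\bot,\text{NON-ELECTED},\text{ELECTED}\}$, initially $\bot$. Here $\log$ is the natural logarithm. Let $\mathbf A$ be the transition matrix of the simple random walk ($a_{ij}=1/d_i$ if $ij\in E$, and $0$ otherwise), let $\pi_k=\pi_0\mathbf A^k$ (row vectors), and let $\pi_*=(d_i/(2|E|))_i$. The mixing time $\tau(G,n)$ is the least $k$ such that $\|\pi_k\mathbf A-\pi_*\|_\infty\le\frac1{2n}$ for all starting distributions $\pi_0$. **Algorithm.** Put $\rho=2\lceil\sqrt{n\log n}\,\rceil$. * *Initialization.* Each node becomes a candidate with probability $2\log n/n$ and draws a uniform rank from $\{1,\dots,n^4\}$, all independently. A candidate of rank $r$ creates $\rho$ tokens of rank $r$,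 and sets winner-so-far $=r$ and origin $=$ itself; for other nodes winner-so-far is $\bot$. * *Random walks (rounds $0,\dots,\tau$).* A node holding $k$ tokens of rank $r$ samples a port uniformly and independently $k$ times and, for every port chosen $k_x>0$ times, sends the message $\langle r,k_x\rangle$ through it. A node discards every received token whose rank is smaller than the rank of some token that it has seen so far, in the same round or before (own tokens included). The received tokens that are not discarded have the same rank and are merged, adding their counts. If their rank differs from winner-so-far, the node sets winner-so-far to this rank and origin to an arbitrary one of the ports through which tokens of this rank have just arrived. * *Notification (rounds $\tau+1,\dots,2\tau+1$).* At the end of round $\tau$, a node holding $k>0$ tokens of rank $r$ issues $k$ "winner" notifications for $r$. In each of the following rounds, all notifications for $r$ that a node has just issued or received are counted by the node if it is a candidate of rank $r$; otherwise they are forwarded as one message $\langle\mathrm{WIN},r,\mathit{cnt}\rangle$ to origin if winner-so-far $=r$, and dropped if not. * *Decision (end of round $2\tau+1$).* A candidate that has counted $\rho$ notifications becomes ELECTED; every other node becomes NON-ELECTED. **Theorem.** There are absolute constants $c>0$ and $K$ such that for every connected non-bipartite graph $G$ with $n$ nodes and mixing time $\tau=\tau(G,n)$, every port numbering and every rule for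 the arbitrary choice of origin, the following holds. 1. In every execution every message has at most $K\log n$ bits, and in all rounds $t\ge K\tau$ no message is sent and no status changes. 2. With probability at least $1-n^{-c}$, both of the following hold: whenever at least $K\tau$ rounds have been executed, exactly one node is ELECTED and all other nodes are NON-ELECTED; and the total number of messages sent during the whole execution is at most $K\,\tau\sqrt n\,\log^{3/2}n$. -/

import Mathlib

open MeasureTheory

noncomputable section

/-! ### Random walks and the mixing time -/

/-- Transition matrix of the simple random walk: `a i j = 1 / d_i` if `i ~ j`, else `0`. -/
def transitionMatrix {V : Type*} [Fintype V] (G : SimpleGraph V) [DecidableRel G.Adj] :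
    Matrix V V ℝ :=
  fun i j => if G.Adj i j then 1 / (G.degree i : ℝ) else 0

/-- Stationary distribution, with entries `d_i / (2 |E|)`. -/
def stationary {V : Type*} [Fintype V] (G : SimpleGraph V) [DecidableRel G.Adj] : V → ℝ :=
  fun i => (G.degree i : ℝ) / (2 * (G.edgeFinset.card : ℝ))

/-- Distribution `π_k` of the walk after `k` steps, started from `π₀`.  The transition matrix is
row-stochastic, so distributions are row vectors. -/
def walkDist {V : Type*} [Fintype V] [DecidableEq V] (G : SimpleGraph V) [DecidableRel G.Adj]
    (π₀ : V → ℝ) (k : ℕ) : V → ℝ :=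
  Matrix.vecMul π₀ (transitionMatrix G ^ k)

/-- The mixing time: the least `k` such that, for all starting distributions `π₀`, one further
step from `π_k` leads within `1 / (2n)` of the stationary distribution in the maximum norm
(which is the norm of `V → ℝ`). -/
def mixingTime {V : Type*} [Fintype V] [DecidableEq V] (G : SimpleGraph V) [DecidableRel G.Adj] :
    ℕ :=
  sInf {k : ℕ | ∀ π₀ ∈ stdSimplex ℝ V,
    ‖Matrix.vecMul (walkDist G π₀ k) (transitionMatrix G) - stationary G‖
      ≤ 1 / (2 * (Fintype.card V : ℝ))}

/-! ### Anonymous synchronous networks with private coins -/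

/-- The status variable of a node. -/
inductive Status where
  | undecided
  | nonElected
  | elected

/-- A port numbering: every node names its incident edges `0, …, deg - 1`. -/
abbrev PortNumbering {V : Type*} [Fintype V] (G : SimpleGraph V) [DecidableRel G.Adj] : Type _ :=
  (v : V) → Fin (G.degree v) ≃ G.neighborSet v

/-- A uniform randomized algorithm for anonymous synchronous networks.  All nodes run the same
program.  A node knows only its degree `d`, its private coins, its state and what it receives.
In every round a node sends at most one message through each of its ports, and then updates its
state from the messages received in that round. -/
structure Protocol where
  Coins : ℕ → Type
  measurableCoins : ∀ d, MeasurableSpace (Coins d)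
  law : ∀ d, Measure (Coins d)
  State : ℕ → Type
  Msg : Type
  /-- The bit string by which a message is transmitted. -/
  encode : Msg → List Bool
  encode_injective : Function.Injective encode
  init : ∀ d, Coins d → State d
  send : ∀ d, Coins d → State d → Fin d → Option Msg
  receive : ∀ d, Coins d → State d → (Fin d → Option Msg) → State d
  status : ∀ d, State d → Status

attribute [instance] Protocol.measurableCoins

namespace Protocol

variable {V : Type*} [Fintype V] {G : SimpleGraph V} [DecidableRel G.Adj]

/-- Outcomes of all private coins in the network. -/
abbrev Outcome (A : Protocol) (G : SimpleGraph V) [DecidableRel G.Adj] : Type _ :=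
  (v : V) → A.Coins (G.degree v)

/-- The coins of different nodes are independent. -/
def prob (A : Protocol) (G : SimpleGraph V) [DecidableRel G.Adj] : Measure (A.Outcome G) :=
  Measure.pi fun v => A.law (G.degree v)

/-- What node `v` finds at its port `y`, if every node `u` sends `out u x` through port `x`. -/
def deliver {M : Type} (ports : PortNumbering G) (out : (v : V) → Fin (G.degree v) → Option M)
    (v : V) (y : Fin (G.degree v)) : Option M :=
  out (ports v y) ((ports (ports v y)).symm ⟨v, (ports v y).2.symm⟩)

/-- The states of all nodes after `t` rounds (equivalently, at the start of round `t`, where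
rounds are numbered `0, 1, 2, …`). -/
def run (A : Protocol) (ports : PortNumbering G) (ω : A.Outcome G) :
    ℕ → (v : V) → A.State (G.degree v)
  | 0 => fun v => A.init _ (ω v)
  | t + 1 => fun v =>
      A.receive _ (ω v) (run A ports ω t v)
        (deliver ports (fun u x => A.send _ (ω u) (run A ports ω t u) x) v)

/-- The message (if any) that `v` sends through port `x` in round `t`. -/
def sent (A : Protocol) (ports : PortNumbering G) (ω : A.Outcome G) (t : ℕ) (v : V)
    (x : Fin (G.degree v)) : Option A.Msg :=
  A.send _ (ω v) (A.run ports ω t v) x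

/-- Number of messages sent in the whole network during the first `t` rounds. -/
def messages (A : Protocol) (ports : PortNumbering G) (ω : A.Outcome G) (t : ℕ) : ℕ :=
  ∑ s ∈ Finset.range t, ∑ v : V,
    (Finset.univ.filter fun x => (A.sent ports ω s v x).isSome = true).card

/-- After `t` rounds exactly one node is elected and all other nodes are non-elected. -/
def LeaderAt (A : Protocol) (ports : PortNumbering G) (ω : A.Outcome G) (t : ℕ) : Prop :=
  ∃ l : V, A.status _ (A.run ports ω t l) = Status.elected ∧
    ∀ v : V, v ≠ l → A.status _ (A.run ports ω t v) = Status.nonElected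

/-- In every execution every message has at most `B` bits.  (That at most one message per round
crosses an edge in each direction is built into `Protocol`.) -/
def MessageSizeLE (A : Protocol) (ports : PortNumbering G) (B : ℝ) : Prop :=
  ∀ (ω : A.Outcome G) (t : ℕ) (v : V) (x : Fin (G.degree v)) (m : A.Msg),
    A.sent ports ω t v x = some m → ((A.encode m).length : ℝ) ≤ B

/-- In every execution, no message is sent and no status changes in the rounds `t ≥ B`. -/
def HaltsWithin (A : Protocol) (ports : PortNumbering G) (B : ℝ) : Prop :=
  ∀ (ω : A.Outcome G) (t : ℕ), B ≤ (t : ℝ) → ∀ v : V,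
    (∀ x, A.sent ports ω t v x = none) ∧
      A.status _ (A.run ports ω (t + 1) v) = A.status _ (A.run ports ω t v)

end Protocol

/-! ### The random-walk leader election algorithm

`n` is the number of nodes and `T` the mixing time, both known to the nodes. -/

namespace Election

/-- The ranks `1, …, n ^ 4`. -/
abbrev Rank (n : ℕ) : Type := Set.Icc 1 (n ^ 4)

/-- `2 ⌈√(n log n)⌉`, the number of tokens (competitions) of a candidate. -/
def numTokens (n : ℕ) : ℕ := 2 * ⌈Real.sqrt ((n : ℝ) * Real.log n)⌉₊

/-- `token r k` stands for `k` random walks of the candidate of rank `r`;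
`win r k` stands for `k` winner notifications for rank `r`. -/
inductive Msg (n : ℕ) where
  | token (r : Rank n) (k : ℕ)
  | win (r : Rank n) (k : ℕ)

/-- Injective numbering of the messages, transmitted in binary. -/
def Msg.code {n : ℕ} : Msg n → ℕ
  | .token r k => 2 * Nat.pair r.1 k
  | .win r k => 2 * Nat.pair r.1 k + 1

theorem Msg.code_injective {n : ℕ} : Function.Injective (Msg.code (n := n)) := by
  rintro (⟨r, k⟩ | ⟨r, k⟩) (⟨r', k'⟩ | ⟨r', k'⟩) h <;> simp only [Msg.code] at h
  · have := Nat.pair_eq_pair.1 (by omega : Nat.pair r.1 k = Nat.pair r'.1 k')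
    rw [Subtype.ext this.1, this.2]
  · omega
  · omega
  · have := Nat.pair_eq_pair.1 (by omega : Nat.pair r.1 k = Nat.pair r'.1 k')
    rw [Subtype.ext this.1, this.2]

theorem bits_injective : Function.Injective Nat.bits := by
  intro a
  induction a using Nat.binaryRec' with
  | zero =>
    intro b h
    induction b using Nat.binaryRec' with
    | zero => rfl
    | bit c m hm _ => rw [Nat.bits_append_bit m c hm] at h; simp at h
  | bit b a ha ih =>
    intro b' h
    induction b' using Nat.binaryRec' with
    | zero => rw [Nat.bits_append_bit a b ha] at h; simp at h
    | bit c m hm _ =>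
      rw [Nat.bits_append_bit a b ha, Nat.bits_append_bit m c hm] at h
      obtain ⟨h1, h2⟩ := List.cons.inj h
      rw [h1, ih h2]

/-- Rank of a received token (`⊥` if there is none). -/
def tokenRank {n : ℕ} : Option (Msg n) → WithBot (Rank n)
  | some (.token r _) => (r : WithBot (Rank n))
  | _ => ⊥

/-- Number of walks represented by a received token. -/
def tokenCount {n : ℕ} : Option (Msg n) → ℕ
  | some (.token _ k) => k
  | _ => 0

/-- Rank of a received winner notification (`⊥` if there is none). -/
def winRank {n : ℕ} : Option (Msg n) → WithBot (Rank n)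
  | some (.win r _) => (r : WithBot (Rank n))
  | _ => ⊥

/-- Number of winner notifications represented by a received message. -/
def winCount {n : ℕ} : Option (Msg n) → ℕ
  | some (.win _ k) => k
  | _ => 0

/-- Private coins of a node of degree `d`: whether it is a candidate, its rank, and for each
round `0, …, T` and each rank a supply of random ports.  At most `n * numTokens n` tokens
exist in the network, so the supply is never exhausted. -/
abbrev Coins (n T d : ℕ) : Type :=
  Bool × Rank n × (Fin (T + 1) × Rank n × Fin (n * numTokens n) → Fin d)

/-- Distribution of `true` with probability `2 log n / n`, which is at most `1`. -/
def candidateLaw (n : ℕ) : Measure Bool :=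
  ENNReal.ofReal (2 * Real.log n / n) • Measure.dirac true +
    ENNReal.ofReal (1 - 2 * Real.log n / n) • Measure.dirac false

/-- Candidacy, rank and all the ports are independent; rank and ports are uniform. -/
def coinLaw (n T d : ℕ) : Measure (Coins n T d) :=
  (candidateLaw n).prod
    ((ProbabilityTheory.uniformOn (Set.univ : Set (Rank n))).prod
      (Measure.pi fun _ => ProbabilityTheory.uniformOn (Set.univ : Set (Fin d))))

/-- State of a node of degree `d`. -/
structure State (n d : ℕ) where
  /-- number of rounds executed -/
  clock : ℕ
  /-- own rank, `⊥` if the node is not a candidate -/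
  own : WithBot (Rank n)
  /-- winner-so-far: the largest rank among all tokens seen, own tokens included -/
  best : WithBot (Rank n)
  /-- port from which rank `best` was first received; `none` is the node itself -/
  origin : Option (Fin d)
  /-- number of tokens of rank `best` held by the node -/
  held : ℕ
  /-- number of winner notifications for `best` still to be forwarded to `origin` -/
  pending : ℕ
  /-- number of winner notifications received for the own rank -/
  wins : ℕ
  status : Status

/-- A candidate starts with `numTokens n` tokens of its own rank. -/
def init (n T d : ℕ) (ω : Coins n T d) : State n d where
  clock := 0
  own := if ω.1 then (ω.2.1 : WithBot (Rank n)) else ⊥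
  best := if ω.1 then (ω.2.1 : WithBot (Rank n)) else ⊥
  origin := none
  held := if ω.1 then numTokens n else 0
  pending := 0
  wins := 0
  status := Status.undecided

/-- If `k` tokens of rank `r` are forwarded in round `t`, by `k` samples of a port, this is the
number of times that port `x` is chosen. -/
def sampleCount {n T d : ℕ} (ω : Coins n T d) (t : Fin (T + 1)) (r : Rank n) (k : ℕ)
    (x : Fin d) : ℕ :=
  (Finset.univ.filter fun j : Fin (n * numTokens n) => j.1 < k ∧ ω.2.2 (t, r, j) = x).card

/-- Rounds `0, …, T`: forward the held tokens, sending only their counts.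
Rounds `T + 1, …, 2 T + 1`: forward the pending winner notifications to `origin`.
Afterwards the node is silent. -/
def send (n T d : ℕ) (ω : Coins n T d) (s : State n d) (x : Fin d) : Option (Msg n) :=
  match s.best with
  | ⊥ => none
  | (r : Rank n) =>
    if h : s.clock < T + 1 then
      let k := sampleCount ω ⟨s.clock, h⟩ r s.held x
      if 0 < k then some (.token r k) else none
    else if s.clock < 2 * (T + 1) ∧ 0 < s.pending ∧ s.origin = some x then
      some (.win r s.pending)
    else none

/-- A rule for choosing one among several ports that brought the new winner-so-far. -/
abbrev PortChoice : Type := (d : ℕ) → (s : Finset (Fin d)) → s.Nonempty → {x : Fin d // x ∈ s}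

/-- Reception in rounds `0, …, T`: tokens of rank below the largest rank ever seen are discarded,
those of the largest rank are merged.  At the end of round `T` the walks are over: the node issues
one winner notification per token that it holds. -/
def receiveToken {n d : ℕ} (T : ℕ) (pick : PortChoice) (s : State n d)
    (inbox : Fin d → Option (Msg n)) : State n d :=
  let best' := s.best ⊔ Finset.univ.sup fun x => tokenRank (inbox x)
  let from' := Finset.univ.filter fun x => tokenRank (inbox x) = best'
  let held' := ∑ x, if tokenRank (inbox x) = best' then tokenCount (inbox x) else 0
  { s with
    clock := s.clock + 1
    best := best'
    origin := if h : best' ≠ s.best ∧ from'.Nonempty then some (pick d from' h.2).1 else s.origin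
    held := held'
    pending := if s.clock = T ∧ s.own ≠ best' then held' else 0
    wins := if s.clock = T ∧ s.own = best' then held' else 0 }

/-- Reception in rounds `T + 1, …, 2 T + 1`: notifications for the own rank are counted, those for
the winner-so-far are merged, to be forwarded, all others are dropped.  The status is set at the
end of round `2 T + 1`. -/
def receiveWin {n d : ℕ} (T : ℕ) (s : State n d) (inbox : Fin d → Option (Msg n)) : State n d :=
  let wins' := s.wins + ∑ x, if winRank (inbox x) = s.own then winCount (inbox x) else 0
  { s with
    clock := s.clock + 1
    pending := ∑ x, if winRank (inbox x) = s.best ∧ winRank (inbox x) ≠ s.own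
      then winCount (inbox x) else 0
    wins := wins'
    status :=
      if s.clock = 2 * T + 1 then
        if s.own ≠ ⊥ ∧ wins' = numTokens n then Status.elected else Status.nonElected
      else s.status }

/-- State update at the end of a round. -/
def receive (n T d : ℕ) (pick : PortChoice) (s : State n d) (inbox : Fin d → Option (Msg n)) :
    State n d :=
  if s.clock < T + 1 then receiveToken T pick s inbox
  else if s.clock < 2 * (T + 1) then receiveWin T s inbox
  else s

/-- The leader election algorithm with parameters `n` (number of nodes) and `T` (mixing time). -/
def algorithm (n T : ℕ) (pick : PortChoice) : Protocol where
  Coins := Coins n T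
  measurableCoins := fun _ => inferInstance
  law := coinLaw n T
  State := State n
  Msg := Msg n
  encode := fun m => Nat.bits m.code
  encode_injective := bits_injective.comp Msg.code_injective
  init := init n T
  send := send n T
  receive := fun d _ s inbox => receive n T d pick s inbox
  status := fun _ s => s.status

/-- The algorithm on the network `G`, with its true size and mixing time as parameters. -/
def algorithmOn {V : Type*} [Fintype V] [DecidableEq V] (G : SimpleGraph V) [DecidableRel G.Adj]
    (pick : PortChoice) : Protocol :=
  algorithm (Fintype.card V) (mixingTime G) pick

end Election

end

set_option linter.unusedSectionVars false

/-! ### Convergence of the simple random walk -/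

section RandomWalk

variable {V : Type*} [Fintype V] [DecidableEq V] {G : SimpleGraph V} [DecidableRel G.Adj]

theorem SimpleGraph.three_le_card_of_not_isBipartite (hb : ¬ G.IsBipartite) :
    3 ≤ Fintype.card V := by
  by_contra h
  exact hb (G.colorable_of_fintype.mono (by omega))

theorem SimpleGraph.Connected.degree_pos_of_not_isBipartite (hc : G.Connected)
    (hb : ¬ G.IsBipartite) (v : V) : 0 < G.degree v := by
  have h3 := SimpleGraph.three_le_card_of_not_isBipartite hb
  have : Nontrivial V := Fintype.one_lt_card_iff_nontrivial.1 (by omega)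
  exact hc.preconnected.degree_pos_of_nontrivial v

/-- In a connected non-bipartite graph there are walks of all sufficiently large lengths between
any two vertices. -/
theorem SimpleGraph.Connected.exists_walk_length_eq (hc : G.Connected) (hb : ¬ G.IsBipartite)
    (u w : V) : ∃ N, ∀ k ≥ N, ∃ p : G.Walk u w, p.length = k := by
  have hodd : ∃ z, ∃ q : G.Walk z z, Odd q.length := by
    by_contra h
    push Not at h
    exact hb (SimpleGraph.two_colorable_iff_forall_loop_even.2 fun z q =>
      Nat.not_odd_iff_even.1 (h z q))
  obtain ⟨z, q, hq⟩ := hodd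
  obtain ⟨p₁⟩ := hc.preconnected u z
  obtain ⟨p₂⟩ := hc.preconnected z w
  have hdeg := hc.degree_pos_of_not_isBipartite hb w
  obtain ⟨x, hx⟩ := (G.degree_pos_iff_exists_adj w).1 hdeg
  have hext : ∀ (p : G.Walk u w) (m : ℕ), ∃ p' : G.Walk u w, p'.length = p.length + 2 * m := by
    intro p m
    induction m with
    | zero => exact ⟨p, rfl⟩
    | succ m ih =>
      obtain ⟨p', hp'⟩ := ih
      refine ⟨p'.append (.cons hx (.cons hx.symm .nil)), ?_⟩
      simp [hp']
      ring
  refine ⟨p₁.length + q.length + p₂.length, fun k hk => ?_⟩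
  by_cases hpar : Even (k - (p₁.length + q.length + p₂.length))
  · obtain ⟨m, hm⟩ := hpar
    obtain ⟨p', hp'⟩ := hext (p₁.append (q.append p₂)) m
    refine ⟨p', ?_⟩
    simp at hp'
    omega
  · obtain ⟨m, hm⟩ := Nat.not_even_iff_odd.1 hpar
    obtain ⟨a, ha⟩ := hq
    obtain ⟨p', hp'⟩ := hext (p₁.append p₂) (m + a + 1)
    refine ⟨p', ?_⟩
    simp at hp'
    omega

theorem transitionMatrix_nonneg (i j : V) : 0 ≤ transitionMatrix G i j := by
  unfold transitionMatrix; split_ifs <;> positivity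

theorem transitionMatrix_pos {i j : V} (h : G.Adj i j) : 0 < transitionMatrix G i j := by
  have : 0 < G.degree i := (G.degree_pos_iff_exists_adj i).2 ⟨j, h⟩
  unfold transitionMatrix
  rw [if_pos h]
  positivity

theorem transitionMatrix_row_sum {i : V} (h : 0 < G.degree i) :
    ∑ j, transitionMatrix G i j = 1 := by
  have h' : (G.degree i : ℝ) ≠ 0 := by exact_mod_cast h.ne'
  unfold transitionMatrix
  rw [← Finset.sum_filter, Finset.sum_const, ← SimpleGraph.neighborFinset_eq_filter,
    SimpleGraph.card_neighborFinset_eq_degree, nsmul_eq_mul]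
  field_simp

theorem transitionMatrix_pow_nonneg (k : ℕ) (i j : V) : 0 ≤ (transitionMatrix G ^ k) i j := by
  induction k generalizing i with
  | zero => rw [pow_zero, Matrix.one_apply]; split_ifs <;> norm_num
  | succ k ih =>
    rw [pow_succ', Matrix.mul_apply]
    exact Finset.sum_nonneg fun l _ => mul_nonneg (transitionMatrix_nonneg _ _) (ih l)

theorem transitionMatrix_pow_row_sum (h : ∀ v, 0 < G.degree v) (k : ℕ) (i : V) :
    ∑ j, (transitionMatrix G ^ k) i j = 1 := by
  induction k generalizing i with
  | zero => simp [Matrix.one_apply]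
  | succ k ih =>
    simp_rw [pow_succ', Matrix.mul_apply]
    rw [Finset.sum_comm]
    simp_rw [← Finset.mul_sum, ih, mul_one]
    exact transitionMatrix_row_sum (h i)

theorem transitionMatrix_pow_pos_of_walk {u w : V} (p : G.Walk u w) :
    0 < (transitionMatrix G ^ p.length) u w := by
  induction p with
  | nil => simp
  | @cons a b c hab p ih =>
    rw [SimpleGraph.Walk.length_cons, pow_succ', Matrix.mul_apply]
    exact Finset.sum_pos' (fun l _ => mul_nonneg (transitionMatrix_nonneg _ _)
      (transitionMatrix_pow_nonneg _ _ _))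
      ⟨b, Finset.mem_univ _, mul_pos (transitionMatrix_pos hab) ih⟩

theorem exists_transitionMatrix_pow_pos (hc : G.Connected) (hb : ¬ G.IsBipartite) :
    ∃ N, 0 < N ∧ ∀ u w, 0 < (transitionMatrix G ^ N) u w := by
  choose N hN using fun p : V × V => hc.exists_walk_length_eq hb p.1 p.2
  refine ⟨Finset.univ.sup N + 1, by omega, fun u w => ?_⟩
  obtain ⟨p, hp⟩ := hN (u, w) (Finset.univ.sup N + 1)
    ((Finset.le_sup (f := N) (Finset.mem_univ (u, w))).trans (Nat.le_succ _))
  rw [← hp]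
  exact transitionMatrix_pow_pos_of_walk p

theorem sum_stationary (h : ∀ v, 0 < G.degree v) [Nonempty V] : ∑ v, stationary G v = 1 := by
  unfold stationary
  rw [← Finset.sum_div, ← Nat.cast_sum, SimpleGraph.sum_degrees_eq_twice_card_edges]
  have : 0 < ∑ v, G.degree v :=
    Finset.sum_pos (fun v _ => h v) Finset.univ_nonempty
  rw [SimpleGraph.sum_degrees_eq_twice_card_edges] at this
  push_cast
  exact div_self (by exact_mod_cast this.ne')

theorem stationary_nonneg (v : V) : 0 ≤ stationary G v := by
  unfold stationary; positivity

theorem stationary_vecMul (h : ∀ v, 0 < G.degree v) :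
    Matrix.vecMul (stationary G) (transitionMatrix G) = stationary G := by
  funext j
  simp only [Matrix.vecMul, dotProduct, stationary, transitionMatrix]
  have : ∀ i, (G.degree i : ℝ) / (2 * (G.edgeFinset.card : ℝ)) *
      (if G.Adj i j then 1 / (G.degree i : ℝ) else 0) =
      (if G.Adj j i then 1 else 0) / (2 * (G.edgeFinset.card : ℝ)) := by
    intro i
    have h' : (G.degree i : ℝ) ≠ 0 := by exact_mod_cast (h i).ne'
    by_cases hij : G.Adj i j
    · rw [if_pos hij, if_pos hij.symm]; field_simp
    · rw [if_neg hij, if_neg fun h => hij h.symm]; simp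
  simp_rw [this]
  rw [← Finset.sum_div, ← Finset.sum_filter, Finset.sum_const,
    ← SimpleGraph.neighborFinset_eq_filter, SimpleGraph.card_neighborFinset_eq_degree]
  simp

theorem stationary_vecMul_pow (h : ∀ v, 0 < G.degree v) (k : ℕ) :
    Matrix.vecMul (stationary G) (transitionMatrix G ^ k) = stationary G := by
  induction k with
  | zero => simp
  | succ k ih => rw [pow_succ', ← Matrix.vecMul_vecMul, stationary_vecMul h, ih]

/-- A row-stochastic matrix with entries at least `δ` contracts the `ℓ¹` norm on vectors of sum
zero. -/
theorem Matrix.sum_abs_vecMul_le {ι : Type*} [Fintype ι] {P : Matrix ι ι ℝ} {δ : ℝ}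
    (hδ : ∀ i j, δ ≤ P i j) (hP : ∀ i, ∑ j, P i j = 1) {x : ι → ℝ} (hx : ∑ i, x i = 0) :
    ∑ j, |Matrix.vecMul x P j| ≤ (1 - Fintype.card ι * δ) * ∑ i, |x i| := by
  have h1 : ∀ j, Matrix.vecMul x P j = ∑ i, x i * (P i j - δ) := by
    intro j
    simp_rw [mul_sub, Finset.sum_sub_distrib, ← Finset.sum_mul, hx]
    simp [Matrix.vecMul, dotProduct]
  calc ∑ j, |Matrix.vecMul x P j| ≤ ∑ j, ∑ i, |x i| * (P i j - δ) := by
        refine Finset.sum_le_sum fun j _ => ?_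
        rw [h1]
        refine (Finset.abs_sum_le_sum_abs _ _).trans (Finset.sum_le_sum fun i _ => ?_)
        rw [abs_mul, abs_of_nonneg (sub_nonneg.2 (hδ i j))]
    _ = (1 - Fintype.card ι * δ) * ∑ i, |x i| := by
        rw [Finset.sum_comm, Finset.mul_sum]
        refine Finset.sum_congr rfl fun i _ => ?_
        rw [← Finset.mul_sum, Finset.sum_sub_distrib, hP]
        simp
        ring

theorem Matrix.sum_vecMul_of_row_sum {ι : Type*} [Fintype ι] {P : Matrix ι ι ℝ}
    (hP : ∀ i, ∑ j, P i j = 1) (x : ι → ℝ) : ∑ j, Matrix.vecMul x P j = ∑ i, x i := by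
  simp only [Matrix.vecMul, dotProduct]
  rw [Finset.sum_comm]
  simp_rw [← Finset.mul_sum, hP, mul_one]

theorem mixingTime_spec (hc : G.Connected) (hb : ¬ G.IsBipartite) :
    ∀ π₀ ∈ stdSimplex ℝ V,
      ‖Matrix.vecMul (walkDist G π₀ (mixingTime G)) (transitionMatrix G) - stationary G‖
        ≤ 1 / (2 * (Fintype.card V : ℝ)) := by
  have hdeg := hc.degree_pos_of_not_isBipartite hb
  have := hc.nonempty
  have hn : (0 : ℝ) < Fintype.card V := by exact_mod_cast Fintype.card_pos
  refine Nat.sInf_mem (s := {k : ℕ | ∀ π₀ ∈ stdSimplex ℝ V,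
    ‖Matrix.vecMul (walkDist G π₀ k) (transitionMatrix G) - stationary G‖
      ≤ 1 / (2 * (Fintype.card V : ℝ))}) ?_
  obtain ⟨N, hN, hpos⟩ := exists_transitionMatrix_pow_pos hc hb
  obtain ⟨p, -, hp⟩ := Finset.exists_min_image (Finset.univ : Finset (V × V))
    (fun p => (transitionMatrix G ^ N) p.1 p.2) Finset.univ_nonempty
  set δ := (transitionMatrix G ^ N) p.1 p.2 with hδ
  have hδ0 : 0 < δ := hpos _ _
  have hle : ∀ i j, δ ≤ (transitionMatrix G ^ N) i j := fun i j => hp (i, j) (Finset.mem_univ _)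
  have hrow := transitionMatrix_pow_row_sum hdeg (G := G) N
  set r := 1 - Fintype.card V * δ with hr
  have hr1 : r < 1 := by have := mul_pos hn hδ0; linarith
  have hr0 : 0 ≤ r := by
    obtain ⟨i⟩ := ‹Nonempty V›
    have : ∑ _j : V, δ ≤ ∑ j, (transitionMatrix G ^ N) i j := Finset.sum_le_sum fun j _ => hle i j
    rw [hrow] at this
    simp at this
    linarith
  have hcontr : ∀ (x : V → ℝ), ∑ i, x i = 0 → ∀ m : ℕ,
      ∑ j, |Matrix.vecMul x ((transitionMatrix G ^ N) ^ m) j| ≤ r ^ m * ∑ i, |x i| := by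
    intro x hx m
    induction m with
    | zero => simp
    | succ m ih =>
      rw [pow_succ, ← Matrix.vecMul_vecMul]
      refine (Matrix.sum_abs_vecMul_le hle hrow ?_).trans ?_
      · rw [← pow_mul, Matrix.sum_vecMul_of_row_sum (transitionMatrix_pow_row_sum hdeg _), hx]
      · rw [pow_succ', mul_assoc]
        exact mul_le_mul_of_nonneg_left ih hr0
  obtain ⟨m, hm⟩ := exists_pow_lt_of_lt_one (show (0 : ℝ) < 1 / (4 * Fintype.card V) from
    div_pos one_pos (by linarith)) hr1
  have hm1 : r ^ (m + 1) ≤ 1 / (4 * Fintype.card V) :=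
    (pow_le_pow_of_le_one hr0 hr1.le (Nat.le_succ m)).trans hm.le
  refine ⟨N * (m + 1) - 1, fun π₀ hπ => ?_⟩
  have hk : N * (m + 1) - 1 + 1 = N * (m + 1) := Nat.succ_pred_eq_of_pos (Nat.mul_pos hN m.succ_pos)
  have heq : Matrix.vecMul (walkDist G π₀ (N * (m + 1) - 1)) (transitionMatrix G) - stationary G =
      Matrix.vecMul (π₀ - stationary G) ((transitionMatrix G ^ N) ^ (m + 1)) := by
    rw [walkDist, Matrix.vecMul_vecMul, ← pow_succ, hk, Matrix.sub_vecMul, ← pow_mul,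
      stationary_vecMul_pow hdeg]
  rw [heq]
  have hx : ∑ i, (π₀ - stationary G) i = 0 := by
    simp [sum_stationary hdeg, hπ.2]
  have hx2 : ∑ i, |(π₀ - stationary G) i| ≤ 2 := by
    calc ∑ i, |(π₀ - stationary G) i| ≤ ∑ i, (π₀ i + stationary G i) := by
          refine Finset.sum_le_sum fun i _ => ?_
          have h1 := hπ.1 i
          have h2 := stationary_nonneg (G := G) i
          rw [Pi.sub_apply, abs_le]
          constructor <;> linarith
      _ = 2 := by rw [Finset.sum_add_distrib, sum_stationary hdeg, hπ.2]; norm_num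
  have hfin : ∑ j, |Matrix.vecMul (π₀ - stationary G) ((transitionMatrix G ^ N) ^ (m + 1)) j|
      ≤ 1 / (2 * (Fintype.card V : ℝ)) := by
    refine (hcontr _ hx (m + 1)).trans ?_
    calc r ^ (m + 1) * ∑ i, |(π₀ - stationary G) i| ≤ 1 / (4 * Fintype.card V) * 2 := by
          gcongr
      _ = _ := by field_simp; norm_num
  rw [pi_norm_le_iff_of_nonneg (by positivity)]
  intro j
  rw [Real.norm_eq_abs]
  exact (Finset.single_le_sum (f := fun j => |Matrix.vecMul (π₀ - stationary G)
    ((transitionMatrix G ^ N) ^ (m + 1)) j|) (fun _ _ => abs_nonneg _)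
    (Finset.mem_univ j)).trans hfin

/-- After `mixingTime G + 1` steps the walk from any vertex is nearly stationary. -/
theorem abs_transitionMatrix_pow_sub_stationary_le (hc : G.Connected) (hb : ¬ G.IsBipartite)
    (u w : V) : |(transitionMatrix G ^ (mixingTime G + 1)) u w - stationary G w|
      ≤ 1 / (2 * (Fintype.card V : ℝ)) := by
  have h := mixingTime_spec hc hb _ (single_mem_stdSimplex ℝ u)
  have h2 := (pi_norm_le_iff_of_nonneg (by positivity)).1 h w
  rw [walkDist, Matrix.vecMul_vecMul, ← pow_succ] at h2
  simpa [Real.norm_eq_abs] using h2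

theorem mixingTime_pos (hc : G.Connected) (hb : ¬ G.IsBipartite) : 0 < mixingTime G := by
  have hdeg := hc.degree_pos_of_not_isBipartite hb
  have := hc.nonempty
  have hn : (0 : ℝ) < Fintype.card V := by exact_mod_cast Fintype.card_pos
  by_contra h0
  have h0 : mixingTime G = 0 := by omega
  have hlt : ∀ v, stationary G v < 1 / (Fintype.card V : ℝ) := by
    intro v
    have h := abs_transitionMatrix_pow_sub_stationary_le hc hb v v
    rw [h0, zero_add, pow_one] at h
    have h1 : transitionMatrix G v v = 0 := by simp [transitionMatrix]
    rw [h1, zero_sub, abs_neg] at h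
    refine ((le_abs_self _).trans h).trans_lt ?_
    apply one_div_lt_one_div_of_lt hn
    linarith
  have := Finset.sum_lt_sum_of_nonempty (s := Finset.univ) Finset.univ_nonempty fun v _ => hlt v
  rw [sum_stationary hdeg] at this
  simp at this

end RandomWalk

/-! ### Ports and the reversal of edges -/

namespace Election

section Ports

variable {V : Type*} [Fintype V] {G : SimpleGraph V} [DecidableRel G.Adj]

/-- The port number, at the other end, of the edge at port `y` of `v`. -/
def backPort (ports : PortNumbering G) (v : V) (y : Fin (G.degree v)) :
    Fin (G.degree (ports v y : V)) :=
  (ports (ports v y)).symm ⟨v, (ports v y).2.symm⟩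

theorem ports_backPort (ports : PortNumbering G) (v : V) (y : Fin (G.degree v)) :
    (ports (ports v y) (backPort ports v y) : V) = v := by
  simp [backPort]

/-- Reversal of edges, as a permutation of all pairs of a node and one of its ports. -/
def reversePort (ports : PortNumbering G) :
    (Σ v : V, Fin (G.degree v)) ≃ (Σ v : V, Fin (G.degree v)) :=
  (Equiv.sigmaCongrRight ports).trans
    ((⟨fun p => ⟨p.2.1, p.1, p.2.2.symm⟩, fun p => ⟨p.2.1, p.1, p.2.2.symm⟩,
        fun _ => rfl, fun _ => rfl⟩ :
      (Σ v : V, G.neighborSet v) ≃ (Σ v : V, G.neighborSet v)).trans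
    (Equiv.sigmaCongrRight ports).symm)

@[to_additive]
theorem prod_reversePort {M : Type*} [CommMonoid M] (ports : PortNumbering G)
    (F : V → (u : V) → Fin (G.degree u) → M) :
    ∏ v, ∏ y, F v (ports v y) (backPort ports v y) = ∏ u, ∏ x, F (ports u x) u x := by
  rw [← Fintype.prod_sigma', ← Fintype.prod_sigma']
  symm
  rw [← Equiv.prod_comp (reversePort ports)]
  symm
  refine Finset.prod_congr rfl fun p _ => ?_
  change _ = F (ports (ports p.1 p.2) (backPort ports p.1 p.2)) (ports p.1 p.2)
    (backPort ports p.1 p.2)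
  rw [ports_backPort]

end Ports

/-! ### Sampling of ports -/

section Sampling

variable {n T d : ℕ} (ω : Coins n T d) (t : Fin (T + 1)) (r : Rank n)

theorem sampleCount_mono {k l : ℕ} (h : k ≤ l) (x : Fin d) :
    sampleCount ω t r k x ≤ sampleCount ω t r l x :=
  Finset.card_le_card fun j => by
    simp only [Finset.mem_filter]
    exact fun hj => ⟨hj.1, hj.2.1.trans_le h, hj.2.2⟩

@[simp]
theorem sampleCount_zero (x : Fin d) : sampleCount ω t r 0 x = 0 := by
  simp [sampleCount]

theorem sum_sampleCount (k : ℕ) :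
    ∑ x, sampleCount ω t r k x =
      (Finset.univ.filter fun j : Fin (n * numTokens n) => j.1 < k).card := by
  rw [Finset.card_eq_sum_card_fiberwise (f := fun j => ω.2.2 (t, r, j)) (t := Finset.univ)
    (fun _ _ => Finset.mem_coe.2 (Finset.mem_univ _))]
  simp only [sampleCount, Finset.filter_filter]

theorem sum_sampleCount_eq {k : ℕ} (hk : k ≤ n * numTokens n) :
    ∑ x, sampleCount ω t r k x = k := by
  rw [sum_sampleCount, Fin.card_filter_val_lt, min_eq_right hk]

theorem sum_sampleCount_le (k : ℕ) : ∑ x, sampleCount ω t r k x ≤ k := by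
  rw [sum_sampleCount, Fin.card_filter_val_lt]
  exact min_le_right _ _

end Sampling

/-! ### Undisturbed random walks -/

section WalkCount

variable {V : Type*} [Fintype V] [DecidableEq V] {G : SimpleGraph V} [DecidableRel G.Adj]
  (ports : PortNumbering G) {n T : ℕ}

/-- Numbers of tokens at all nodes after `t` rounds, if `u` starts with `numTokens n` tokens, which
use the coins for rank `r` and are never discarded. -/
noncomputable def walkCount (ω : (v : V) → Coins n T (G.degree v)) (r : Rank n) (u : V) : ℕ → V → ℕ
  | 0 => fun v => if v = u then numTokens n else 0
  | t + 1 => fun v =>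
      if h : t < T + 1 then
        ∑ y, sampleCount (ω (ports v y)) ⟨t, h⟩ r (walkCount ω r u t (ports v y))
          (backPort ports v y)
      else 0

variable (ω : (v : V) → Coins n T (G.degree v)) (r : Rank n) (u : V)

theorem walkCount_succ {t : ℕ} (h : t < T + 1) (v : V) :
    walkCount ports ω r u (t + 1) v =
      ∑ y, sampleCount (ω (ports v y)) ⟨t, h⟩ r (walkCount ports ω r u t (ports v y))
          (backPort ports v y) := by
  simp [walkCount, h]

theorem sum_walkCount (hn : 0 < n) {t : ℕ} (ht : t ≤ T + 1) :
    ∑ v, walkCount ports ω r u t v = numTokens n := by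
  induction t with
  | zero => simp [walkCount]
  | succ t ih =>
    have ih := ih (by omega)
    have hle : ∀ v, walkCount ports ω r u t v ≤ n * numTokens n := fun v =>
      ((Finset.single_le_sum (f := walkCount ports ω r u t) (fun _ _ => Nat.zero_le _)
        (Finset.mem_univ v)).trans ih.le).trans (Nat.le_mul_of_pos_left _ hn)
    simp_rw [walkCount_succ ports ω r u (show t < T + 1 by omega)]
    rw [sum_reversePort ports fun _ w x =>
      sampleCount (ω w) ⟨t, by omega⟩ r (walkCount ports ω r u t w) x]
    simp_rw [sum_sampleCount_eq _ _ _ (hle _)]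
    exact ih

theorem walkCount_congr {ω ω' : (v : V) → Coins n T (G.degree v)} {t : ℕ}
    (h : ∀ v (s : Fin (T + 1)), s.1 < t → ∀ j, (ω v).2.2 (s, r, j) = (ω' v).2.2 (s, r, j)) :
    walkCount ports ω r u t = walkCount ports ω' r u t := by
  induction t with
  | zero => rfl
  | succ t ih =>
    have ih := ih fun v s hs => h v s (by omega)
    funext v
    by_cases ht : t < T + 1
    · rw [walkCount_succ _ _ _ _ ht, walkCount_succ _ _ _ _ ht, ih]
      refine Finset.sum_congr rfl fun y _ => ?_
      simp only [sampleCount]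
      simp_rw [h (ports v y) ⟨t, ht⟩ (Nat.lt_succ_self t)]
    · simp [walkCount, ht]

end WalkCount

end Election

namespace Election

/-! ### Messages of a single node -/

section Send

variable {n T d : ℕ}

/-- Number of tokens of rank `r` in a message. -/
def tokensOf (r : Rank n) (m : Option (Msg n)) : ℕ :=
  if tokenRank m = r then tokenCount m else 0

/-- Number of notifications for rank `r` in a message. -/
def winsOf (r : Rank n) (m : Option (Msg n)) : ℕ :=
  if winRank m = r then winCount m else 0

/-- Number of tokens of rank `r` held by a node. -/
def heldOf (r : Rank n) (s : State n d) : ℕ := if s.best = r then s.held else 0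

/-- Number of notifications for rank `r` that a node has to forward. -/
def pendingOf (r : Rank n) (s : State n d) : ℕ := if s.best = r then s.pending else 0

variable (ω : Coins n T d) (s : State n d) (x : Fin d)

theorem send_of_best_eq_bot (h : s.best = ⊥) : send n T d ω s x = none := by
  simp only [send, h]

theorem send_of_clock_lt {r : Rank n} (hb : s.best = r) (hc : s.clock < T + 1) :
    send n T d ω s x = if 0 < sampleCount ω ⟨s.clock, hc⟩ r s.held x then
      some (.token r (sampleCount ω ⟨s.clock, hc⟩ r s.held x)) else none := by
  simp only [send, hb, hc, dite_true]

theorem send_of_le_clock {r : Rank n} (hb : s.best = r) (hc : T + 1 ≤ s.clock) :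
    send n T d ω s x = if s.clock < 2 * (T + 1) ∧ 0 < s.pending ∧ s.origin = some x then
      some (.win r s.pending) else none := by
  simp only [send, hb, dif_neg (not_lt.2 hc)]

theorem send_of_two_mul_le_clock (hc : 2 * (T + 1) ≤ s.clock) : send n T d ω s x = none := by
  induction h : s.best using WithBot.recBotCoe with
  | bot => exact send_of_best_eq_bot _ _ _ h
  | coe r =>
    rw [send_of_le_clock _ _ _ h (by omega), if_neg (by omega)]

theorem best_eq_of_tokenRank_send {r : Rank n} (h : tokenRank (send n T d ω s x) = r) :
    s.best = r := by
  induction hb : s.best using WithBot.recBotCoe with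
  | bot => rw [send_of_best_eq_bot _ _ _ hb] at h; simp [tokenRank] at h
  | coe r' =>
    by_cases hc : s.clock < T + 1
    · rw [send_of_clock_lt _ _ _ hb hc] at h
      split_ifs at h <;> simp_all [tokenRank]
    · rw [send_of_le_clock _ _ _ hb (by omega)] at h
      split_ifs at h <;> simp_all [tokenRank]

theorem tokenRank_send_le : tokenRank (send n T d ω s x) ≤ s.best := by
  induction h : tokenRank (send n T d ω s x) using WithBot.recBotCoe with
  | bot => exact bot_le
  | coe r => exact (best_eq_of_tokenRank_send ω s x h).ge

theorem tokensOf_send (hc : s.clock < T + 1) (r : Rank n) :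
    tokensOf r (send n T d ω s x) = sampleCount ω ⟨s.clock, hc⟩ r (heldOf r s) x := by
  induction hb : s.best using WithBot.recBotCoe with
  | bot => simp [send_of_best_eq_bot _ _ _ hb, tokensOf, tokenRank, heldOf, hb]
  | coe r' =>
    rw [send_of_clock_lt _ _ _ hb hc]
    by_cases hr : r' = r
    · subst hr
      split_ifs with h <;> simp_all [tokensOf, tokenRank, tokenCount, heldOf]
    · have : (r' : WithBot (Rank n)) ≠ r := by simpa using hr
      split_ifs with h <;> simp_all [tokensOf, tokenRank, heldOf]

theorem sum_tokenCount_send_le (hc : s.clock < T + 1) :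
    ∑ x, tokenCount (send n T d ω s x) ≤ s.held := by
  induction hb : s.best using WithBot.recBotCoe with
  | bot => simp [send_of_best_eq_bot _ _ _ hb, tokenCount]
  | coe r =>
    refine le_trans (Finset.sum_le_sum fun x _ => ?_)
      (sum_sampleCount_le ω ⟨s.clock, hc⟩ r s.held)
    rw [send_of_clock_lt _ _ _ hb hc]
    split_ifs <;> simp [tokenCount]

theorem card_send_le_held (hc : s.clock < T + 1) :
    (Finset.univ.filter fun x => (send n T d ω s x).isSome = true).card ≤ s.held := by
  refine le_trans ?_ (sum_tokenCount_send_le ω s hc)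
  rw [Finset.card_filter]
  refine Finset.sum_le_sum fun x _ => ?_
  induction hb : s.best using WithBot.recBotCoe with
  | bot => simp [send_of_best_eq_bot _ _ _ hb]
  | coe r =>
    rw [send_of_clock_lt _ _ _ hb hc]
    by_cases h : 0 < sampleCount ω ⟨s.clock, hc⟩ r s.held x
    · simpa [if_pos h, tokenCount] using Nat.succ_le_of_lt h
    · simp [if_neg h]

theorem winsOf_send (hc : T + 1 ≤ s.clock) (hc' : s.clock < 2 * (T + 1)) (r : Rank n) :
    winsOf r (send n T d ω s x) = if s.origin = some x then pendingOf r s else 0 := by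
  induction hb : s.best using WithBot.recBotCoe with
  | bot => simp [send_of_best_eq_bot _ _ _ hb, winsOf, winRank, pendingOf, hb]
  | coe r' =>
    rw [send_of_le_clock _ _ _ hb hc]
    by_cases hr : r' = r
    · subst hr
      by_cases hx : s.origin = some x <;> by_cases hp : 0 < s.pending <;>
        simp_all [winsOf, winRank, winCount, pendingOf]
    · have : (r' : WithBot (Rank n)) ≠ r := by simpa using hr
      by_cases hx : s.origin = some x <;> by_cases hp : 0 < s.pending <;>
        simp_all [winsOf, winRank, pendingOf]

theorem sum_winCount_send_le (hc : T + 1 ≤ s.clock) :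
    ∑ x, winCount (send n T d ω s x) ≤ s.pending := by
  induction hb : s.best using WithBot.recBotCoe with
  | bot => simp [send_of_best_eq_bot _ _ _ hb, winCount]
  | coe r =>
    have h : ∀ x, winCount (send n T d ω s x) ≤ if s.origin = some x then s.pending else 0 := by
      intro x
      rw [send_of_le_clock _ _ _ hb hc]
      split_ifs <;> simp_all [winCount]
    refine (Finset.sum_le_sum fun x _ => h x).trans ?_
    cases s.origin <;> simp

theorem card_send_le_pending (hc : T + 1 ≤ s.clock) :
    (Finset.univ.filter fun x => (send n T d ω s x).isSome = true).card ≤ s.pending := by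
  refine le_trans ?_ (sum_winCount_send_le ω s hc)
  rw [Finset.card_filter]
  refine Finset.sum_le_sum fun x _ => ?_
  induction hb : s.best using WithBot.recBotCoe with
  | bot => simp [send_of_best_eq_bot _ _ _ hb]
  | coe r =>
    rw [send_of_le_clock _ _ _ hb hc]
    by_cases h : s.clock < 2 * (T + 1) ∧ 0 < s.pending ∧ s.origin = some x
    · simpa [if_pos h, winCount] using Nat.succ_le_of_lt h.2.1
    · simp [if_neg h]

end Send

/-! ### Executions -/

section Run

variable {V : Type*} [Fintype V] [DecidableEq V] {G : SimpleGraph V} [DecidableRel G.Adj]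
  (ports : PortNumbering G) {n T : ℕ} (pick : PortChoice)
  (ω : (v : V) → Coins n T (G.degree v))

/-- State of node `v` after `t` rounds. -/
noncomputable def stateAt (t : ℕ) (v : V) : State n (G.degree v) :=
  (algorithm n T pick).run ports ω t v

/-- Message that node `v` finds at its port `y` in round `t`. -/
noncomputable def inboxAt (t : ℕ) (v : V) (y : Fin (G.degree v)) : Option (Msg n) :=
  send n T _ (ω (ports v y)) (stateAt ports pick ω t (ports v y)) (backPort ports v y)

theorem stateAt_zero (v : V) : stateAt ports pick ω 0 v = init n T _ (ω v) := rfl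

theorem stateAt_succ (t : ℕ) (v : V) : stateAt ports pick ω (t + 1) v =
    receive n T _ pick (stateAt ports pick ω t v) (inboxAt ports pick ω t v) := rfl

theorem clock_stateAt {t : ℕ} (ht : t ≤ 2 * (T + 1)) (v : V) :
    (stateAt ports pick ω t v).clock = t := by
  induction t with
  | zero => rfl
  | succ t ih =>
    have ih := ih (by omega)
    rw [stateAt_succ, receive, ih]
    by_cases h : t < T + 1
    · rw [if_pos h]; simp [receiveToken, ih]
    · rw [if_neg h, if_pos (by omega)]; simp [receiveWin, ih]

theorem stateAt_succ_of_lt {t : ℕ} (ht : t < T + 1) (v : V) : stateAt ports pick ω (t + 1) v =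
    receiveToken T pick (stateAt ports pick ω t v) (inboxAt ports pick ω t v) := by
  rw [stateAt_succ, receive, clock_stateAt ports pick ω (by omega), if_pos ht]

theorem stateAt_succ_of_le {t : ℕ} (ht : T + 1 ≤ t) (ht' : t < 2 * (T + 1)) (v : V) :
    stateAt ports pick ω (t + 1) v =
      receiveWin T (stateAt ports pick ω t v) (inboxAt ports pick ω t v) := by
  rw [stateAt_succ, receive, clock_stateAt ports pick ω (by omega), if_neg (by omega), if_pos ht']

theorem stateAt_of_two_mul_le {t : ℕ} (ht : 2 * (T + 1) ≤ t) (v : V) :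
    stateAt ports pick ω t v = stateAt ports pick ω (2 * (T + 1)) v := by
  induction t, ht using Nat.le_induction with
  | base => rfl
  | succ t ht ih =>
    rw [stateAt_succ, receive, ih, clock_stateAt ports pick ω le_rfl, if_neg (by omega),
      if_neg (by omega)]

theorem clock_stateAt_of_two_mul_le {t : ℕ} (ht : 2 * (T + 1) ≤ t) (v : V) :
    (stateAt ports pick ω t v).clock = 2 * (T + 1) := by
  rw [stateAt_of_two_mul_le ports pick ω ht, clock_stateAt ports pick ω le_rfl]

/-- Own rank of a node, `⊥` if the node is not a candidate. -/
def ownRank {n T d : ℕ} (c : Coins n T d) : WithBot (Rank n) :=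
  if c.1 then (c.2.1 : WithBot (Rank n)) else ⊥

theorem own_stateAt (t : ℕ) (v : V) : (stateAt ports pick ω t v).own = ownRank (ω v) := by
  induction t with
  | zero => rfl
  | succ t ih =>
    rw [stateAt_succ, receive]
    split_ifs <;> simp [receiveToken, receiveWin, ih]

/-- Number of candidates. -/
def numCandidates : ℕ := (Finset.univ.filter fun v => (ω v).1 = true).card

theorem sum_held_le {t : ℕ} (ht : t ≤ T + 1) :
    ∑ v, (stateAt ports pick ω t v).held ≤ numCandidates ω * numTokens n := by
  induction t with
  | zero =>
    simp only [stateAt_zero, init]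
    rw [← Finset.sum_filter, Finset.sum_const, smul_eq_mul, numCandidates]
  | succ t ih =>
    refine le_trans ?_ (ih (by omega))
    calc ∑ v, (stateAt ports pick ω (t + 1) v).held
        ≤ ∑ v, ∑ y, tokenCount (inboxAt ports pick ω t v y) := by
          refine Finset.sum_le_sum fun v _ => ?_
          rw [stateAt_succ_of_lt ports pick ω (by omega)]
          simp only [receiveToken]
          refine Finset.sum_le_sum fun y _ => ?_
          split_ifs <;> simp
      _ = ∑ u, ∑ x, tokenCount (send n T _ (ω u) (stateAt ports pick ω t u) x) :=
          sum_reversePort ports fun _ u x =>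
            tokenCount (send n T _ (ω u) (stateAt ports pick ω t u) x)
      _ ≤ ∑ u, (stateAt ports pick ω t u).held := Finset.sum_le_sum fun u _ =>
          sum_tokenCount_send_le _ _ (by rw [clock_stateAt ports pick ω (by omega)]; omega)

theorem pending_stateAt_succ_le (v : V) :
    (stateAt ports pick ω (T + 1) v).pending ≤ (stateAt ports pick ω (T + 1) v).held := by
  rw [stateAt_succ_of_lt ports pick ω (by omega)]
  simp only [receiveToken]
  split_ifs <;> simp

theorem sum_pending_le {t : ℕ} (ht : T + 1 ≤ t) (ht' : t ≤ 2 * (T + 1)) :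
    ∑ v, (stateAt ports pick ω t v).pending ≤ numCandidates ω * numTokens n := by
  induction t, ht using Nat.le_induction with
  | base =>
    exact (Finset.sum_le_sum fun v _ => pending_stateAt_succ_le ports pick ω v).trans
      (sum_held_le ports pick ω le_rfl)
  | succ t ht ih =>
    refine le_trans ?_ (ih (by omega))
    calc ∑ v, (stateAt ports pick ω (t + 1) v).pending
        ≤ ∑ v, ∑ y, winCount (inboxAt ports pick ω t v y) := by
          refine Finset.sum_le_sum fun v _ => ?_
          rw [stateAt_succ_of_le ports pick ω ht (by omega)]
          simp only [receiveWin]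
          refine Finset.sum_le_sum fun y _ => ?_
          split_ifs <;> simp
      _ = ∑ u, ∑ x, winCount (send n T _ (ω u) (stateAt ports pick ω t u) x) :=
          sum_reversePort ports fun _ u x =>
            winCount (send n T _ (ω u) (stateAt ports pick ω t u) x)
      _ ≤ ∑ u, (stateAt ports pick ω t u).pending := Finset.sum_le_sum fun u _ =>
          sum_winCount_send_le _ _ (by rw [clock_stateAt ports pick ω (by omega)]; omega)

theorem sent_eq (t : ℕ) (v : V) (x : Fin (G.degree v)) :
    (algorithm n T pick).sent ports ω t v x =
      send n T _ (ω v) (stateAt ports pick ω t v) x := rfl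

theorem sent_eq_none {t : ℕ} (ht : 2 * (T + 1) ≤ t) (v : V) (x : Fin (G.degree v)) :
    (algorithm n T pick).sent ports ω t v x = none := by
  rw [sent_eq]
  exact send_of_two_mul_le_clock _ _ _ (clock_stateAt_of_two_mul_le ports pick ω ht v).ge

theorem card_sent_le (t : ℕ) : ∑ v : V, (Finset.univ.filter fun x =>
      ((algorithm n T pick).sent ports ω t v x).isSome = true).card ≤
    if t < 2 * (T + 1) then numCandidates ω * numTokens n else 0 := by
  by_cases h1 : t < T + 1
  · rw [if_pos (by omega)]
    refine le_trans (Finset.sum_le_sum fun v _ => ?_) (sum_held_le ports pick ω h1.le)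
    exact card_send_le_held _ _ ((clock_stateAt ports pick ω (by omega) v).trans_lt h1)
  by_cases h2 : t < 2 * (T + 1)
  · rw [if_pos h2]
    refine le_trans (Finset.sum_le_sum fun v _ => ?_)
      (sum_pending_le ports pick ω (not_lt.1 h1) h2.le)
    exact card_send_le_pending _ _
      ((not_lt.1 h1).trans (clock_stateAt ports pick ω (by omega) v).ge)
  · simp [sent_eq_none ports pick ω (not_lt.1 h2)]

theorem messages_le (t : ℕ) : (algorithm n T pick).messages ports ω t ≤
    2 * (T + 1) * (numCandidates ω * numTokens n) := by
  unfold Protocol.messages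
  refine (Finset.sum_le_sum fun s _ => card_sent_le ports pick ω s).trans ?_
  rw [← Finset.sum_filter, Finset.sum_const, smul_eq_mul]
  refine Nat.mul_le_mul_right _ ?_
  calc _ ≤ (Finset.range (2 * (T + 1))).card := Finset.card_le_card fun s hs => by
          simp only [Finset.mem_filter, Finset.mem_range] at hs ⊢; exact hs.2
    _ = _ := Finset.card_range _

theorem numCandidates_le (hn : Fintype.card V = n) : numCandidates ω ≤ n :=
  (Finset.card_le_univ _).trans hn.le

/-- Every message carries a count of at most `n * numTokens n`. -/
theorem code_sent_le (hn : Fintype.card V = n) {t : ℕ} {v : V} {x : Fin (G.degree v)}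
    {m : Msg n} (h : (algorithm n T pick).sent ports ω t v x = some m) :
    ∃ r : Rank n, ∃ k ≤ n * numTokens n, m.code ≤ 2 * Nat.pair r.1 k + 1 := by
  rw [sent_eq] at h
  induction hb : (stateAt ports pick ω t v).best using WithBot.recBotCoe with
  | bot => rw [send_of_best_eq_bot _ _ _ hb] at h; cases h
  | coe r =>
    by_cases h1 : t < T + 1
    · have hc : (stateAt ports pick ω t v).clock < T + 1 := by
        rw [clock_stateAt ports pick ω (by omega)]; exact h1
      rw [send_of_clock_lt _ _ _ hb hc] at h
      split_ifs at h
      cases h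
      refine ⟨r, _, ?_, Nat.le_succ _⟩
      exact (Finset.card_le_univ _).trans (by simp)
    · by_cases h2 : t < 2 * (T + 1)
      · have hc : T + 1 ≤ (stateAt ports pick ω t v).clock := by
          rw [clock_stateAt ports pick ω (by omega)]; omega
        rw [send_of_le_clock _ _ _ hb hc] at h
        split_ifs at h
        cases h
        refine ⟨r, _, ?_, le_rfl⟩
        exact ((Finset.single_le_sum (f := fun v => (stateAt ports pick ω t v).pending)
          (fun _ _ => Nat.zero_le _) (Finset.mem_univ v)).trans
          (sum_pending_le ports pick ω (not_lt.1 h1) h2.le)).trans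
          (Nat.mul_le_mul_right _ (numCandidates_le ω hn))
      · rw [send_of_two_mul_le_clock _ _ _
          (clock_stateAt_of_two_mul_le ports pick ω (not_lt.1 h2) v).ge] at h
        cases h

end Run

end Election

namespace Election

section Correctness

variable {V : Type*} [Fintype V] [DecidableEq V] {G : SimpleGraph V} [DecidableRel G.Adj]
  (ports : PortNumbering G) {n T : ℕ} (pick : PortChoice)
  (ω : (v : V) → Coins n T (G.degree v))

/-! ### The random walks of the algorithm -/

theorem tokensOf_inboxAt {t : ℕ} (ht : t < T + 1) (r : Rank n) (v : V) (y : Fin (G.degree v)) :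
    tokensOf r (inboxAt ports pick ω t v y) =
      sampleCount (ω (ports v y)) ⟨t, ht⟩ r (heldOf r (stateAt ports pick ω t (ports v y)))
        (backPort ports v y) := by
  have hc := clock_stateAt ports pick ω (show t ≤ 2 * (T + 1) by omega) (ports v y)
  rw [inboxAt, tokensOf_send _ _ _ (hc.trans_lt ht)]
  congr 1
  exact Fin.ext hc

theorem heldOf_receiveToken {d : ℕ} (s : State n d) (inbox : Fin d → Option (Msg n)) (r : Rank n) :
    heldOf r (receiveToken T pick s inbox) =
      if (receiveToken T pick s inbox).best = r then ∑ y, tokensOf r (inbox y) else 0 := by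
  unfold heldOf
  split_ifs with h
  · simp only [receiveToken] at h ⊢
    simp only [h, tokensOf]
  · rfl

theorem heldOf_stateAt_succ {t : ℕ} (ht : t < T + 1) (r : Rank n) (v : V) :
    heldOf r (stateAt ports pick ω (t + 1) v) =
      if (stateAt ports pick ω (t + 1) v).best = r then
        ∑ y, sampleCount (ω (ports v y)) ⟨t, ht⟩ r
          (heldOf r (stateAt ports pick ω t (ports v y))) (backPort ports v y)
      else 0 := by
  rw [stateAt_succ_of_lt ports pick ω ht, heldOf_receiveToken]
  simp_rw [tokensOf_inboxAt ports pick ω ht]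

theorem best_stateAt_zero (v : V) : (stateAt ports pick ω 0 v).best = ownRank (ω v) := rfl

theorem heldOf_stateAt_zero {u : V} {r : Rank n} (hu : ownRank (ω u) = r)
    (huniq : ∀ v, ownRank (ω v) = r → v = u) (v : V) :
    heldOf r (stateAt ports pick ω 0 v) = walkCount ports ω r u 0 v := by
  unfold heldOf
  rw [best_stateAt_zero]
  by_cases hv : v = u
  · subst hv
    have : (ω v).1 = true := by
      by_contra h
      simp [ownRank, h] at hu
    simp [hu, walkCount, stateAt_zero, init, this]
  · have : ownRank (ω v) ≠ r := fun h => hv (huniq v h)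
    simp [this, walkCount, hv]

theorem heldOf_le_walkCount {u : V} {r : Rank n} (hu : ownRank (ω u) = r)
    (huniq : ∀ v, ownRank (ω v) = r → v = u) {t : ℕ} (ht : t ≤ T + 1) (v : V) :
    heldOf r (stateAt ports pick ω t v) ≤ walkCount ports ω r u t v := by
  induction t generalizing v with
  | zero => exact (heldOf_stateAt_zero ports pick ω hu huniq v).le
  | succ t ih =>
    have ht' : t < T + 1 := by omega
    rw [heldOf_stateAt_succ ports pick ω ht', walkCount_succ ports ω r u ht']
    split_ifs
    · exact Finset.sum_le_sum fun y _ => sampleCount_mono _ _ _ (ih (by omega) _) _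
    · exact Nat.zero_le _

theorem best_stateAt_succ {t : ℕ} (ht : t < T + 1) (v : V) :
    (stateAt ports pick ω (t + 1) v).best = (stateAt ports pick ω t v).best ⊔
      Finset.univ.sup fun y => tokenRank (inboxAt ports pick ω t v y) := by
  rw [stateAt_succ_of_lt ports pick ω ht]
  rfl

section Max

variable {u : V} {R : Rank n} (hu : ownRank (ω u) = R)
  (huniq : ∀ v, ownRank (ω v) = R → v = u) (hmax : ∀ v, ownRank (ω v) ≤ R)

include hmax in
theorem best_stateAt_le {t : ℕ} (ht : t ≤ T + 1) (v : V) :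
    (stateAt ports pick ω t v).best ≤ R := by
  induction t generalizing v with
  | zero => exact hmax v
  | succ t ih =>
    rw [best_stateAt_succ ports pick ω (by omega)]
    exact sup_le (ih (by omega) v) (Finset.sup_le fun y _ =>
      (tokenRank_send_le _ _ _).trans (ih (by omega) _))

include hmax in
theorem best_stateAt_succ_eq {t : ℕ} (ht : t < T + 1) {v : V}
    (hv : (stateAt ports pick ω t v).best = R) : (stateAt ports pick ω (t + 1) v).best = R := by
  refine le_antisymm (best_stateAt_le ports pick ω hmax ht v) ?_
  rw [best_stateAt_succ ports pick ω ht, hv]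
  exact le_sup_left

include hu huniq hmax in
theorem heldOf_eq_walkCount {t : ℕ} (ht : t ≤ T + 1) (v : V) :
    heldOf R (stateAt ports pick ω t v) = walkCount ports ω R u t v := by
  induction t generalizing v with
  | zero => exact heldOf_stateAt_zero ports pick ω hu huniq v
  | succ t ih =>
    have ht' : t < T + 1 := by omega
    have hsum : ∑ y, sampleCount (ω (ports v y)) ⟨t, ht'⟩ R
          (heldOf R (stateAt ports pick ω t (ports v y))) (backPort ports v y) =
        walkCount ports ω R u (t + 1) v := by
      rw [walkCount_succ ports ω R u ht']
      simp_rw [ih (by omega)]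
    rw [heldOf_stateAt_succ ports pick ω ht', hsum]
    split_ifs with hb
    · rfl
    · rw [← hsum]
      symm
      refine Finset.sum_eq_zero fun y _ => ?_
      rw [← tokensOf_inboxAt ports pick ω ht', tokensOf, if_neg]
      intro hy
      refine hb (le_antisymm (best_stateAt_le ports pick ω hmax ht v) ?_)
      rw [best_stateAt_succ ports pick ω ht', ← hy]
      exact le_sup_of_le_right (Finset.le_sup (f := fun y =>
        tokenRank (inboxAt ports pick ω t v y)) (Finset.mem_univ y))

include hu huniq hmax in
/-- The origin pointers of the nodes that know the largest rank lead to its candidate; the level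
`L v` is the round in which `v` was reached. -/
theorem exists_level {t : ℕ} (ht : t ≤ T + 1) : ∃ L : V → ℕ,
    (∀ v, (stateAt ports pick ω t v).best = R → L v ≤ t) ∧
    ∀ v ≠ u, (stateAt ports pick ω t v).best = R → ∃ x,
      (stateAt ports pick ω t v).origin = some x ∧
      (stateAt ports pick ω t (ports v x)).best = R ∧ L (ports v x) < L v := by
  induction t with
  | zero =>
    refine ⟨fun _ => 0, fun _ _ => le_rfl, fun v hv hb => ?_⟩
    rw [best_stateAt_zero] at hb
    exact absurd (huniq v hb) hv
  | succ t ih =>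
    obtain ⟨L, hL, hO⟩ := ih (by omega)
    have ht' : t < T + 1 := by omega
    refine ⟨fun v => if (stateAt ports pick ω t v).best = R then L v else t + 1,
      fun v _ => ?_, fun v hv hb => ?_⟩
    · dsimp only
      split_ifs with h
      · exact (hL v h).trans (Nat.le_succ t)
      · exact le_rfl
    · have horig : (stateAt ports pick ω (t + 1) v).origin =
          if h : (stateAt ports pick ω (t + 1) v).best ≠ (stateAt ports pick ω t v).best ∧
            (Finset.univ.filter fun x => tokenRank (inboxAt ports pick ω t v x) =
              (stateAt ports pick ω (t + 1) v).best).Nonempty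
          then some (pick _ _ h.2).1 else (stateAt ports pick ω t v).origin := by
        rw [stateAt_succ_of_lt ports pick ω ht']
        rfl
      by_cases hbt : (stateAt ports pick ω t v).best = R
      · obtain ⟨x, hx, hbx, hLx⟩ := hO v hv hbt
        refine ⟨x, ?_, best_stateAt_succ_eq ports pick ω hmax ht' hbx, ?_⟩
        · rw [horig, dif_neg (fun h => h.1 (hb.trans hbt.symm)), hx]
        · simpa [hbt, hbx] using hLx
      · have hne : (Finset.univ.filter fun x => tokenRank (inboxAt ports pick ω t v x) =
              (stateAt ports pick ω (t + 1) v).best).Nonempty := by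
          by_contra hcon
          rw [Finset.not_nonempty_iff_eq_empty, Finset.filter_eq_empty_iff] at hcon
          have hlt : (stateAt ports pick ω t v).best ⊔
              (Finset.univ.sup fun y => tokenRank (inboxAt ports pick ω t v y)) < R := by
            refine max_lt (lt_of_le_of_ne (best_stateAt_le ports pick ω hmax ht'.le v) hbt) ?_
            refine (Finset.sup_lt_iff (WithBot.bot_lt_coe R)).2 fun y _ => lt_of_le_of_ne
              ((tokenRank_send_le _ _ _).trans (best_stateAt_le ports pick ω hmax ht'.le _)) ?_
            rw [← hb]
            exact hcon (Finset.mem_univ y)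
          rw [← best_stateAt_succ ports pick ω ht', hb] at hlt
          exact lt_irrefl _ hlt
        have hcond : (stateAt ports pick ω (t + 1) v).best ≠ (stateAt ports pick ω t v).best ∧
            (Finset.univ.filter fun x => tokenRank (inboxAt ports pick ω t v x) =
              (stateAt ports pick ω (t + 1) v).best).Nonempty :=
          ⟨fun h => hbt (h.symm.trans hb), hne⟩
        rw [dif_pos hcond] at horig
        refine ⟨_, horig, ?_⟩
        have hmem := (pick _ _ hcond.2).2
        rw [Finset.mem_filter] at hmem
        have hbx := best_eq_of_tokenRank_send _ _ _ (hmem.2.trans hb)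
        refine ⟨best_stateAt_succ_eq ports pick ω hmax ht' hbx, ?_⟩
        simp only [hbx, hbt, if_true, if_false]
        exact Nat.lt_succ_of_le (hL _ hbx)

end Max

/-! ### The notifications -/

theorem best_origin_stateAt_of_le {t : ℕ} (ht : T + 1 ≤ t) (ht' : t ≤ 2 * (T + 1)) (v : V) :
    (stateAt ports pick ω t v).best = (stateAt ports pick ω (T + 1) v).best ∧
      (stateAt ports pick ω t v).origin = (stateAt ports pick ω (T + 1) v).origin := by
  induction t, ht using Nat.le_induction with
  | base => exact ⟨rfl, rfl⟩
  | succ t ht ih =>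
    rw [stateAt_succ_of_le ports pick ω ht (by omega)]
    exact ih (by omega)

theorem pending_eq_zero_of_best_eq {t : ℕ} (ht : T + 1 ≤ t) (ht' : t ≤ 2 * (T + 1)) {v : V}
    (hv : ownRank (ω v) = (stateAt ports pick ω t v).best) :
    (stateAt ports pick ω t v).pending = 0 := by
  induction t, ht using Nat.le_induction with
  | base =>
    rw [stateAt_succ_of_lt ports pick ω (by omega)] at hv ⊢
    rw [← own_stateAt ports pick ω T v] at hv
    exact if_neg fun h => h.2 hv
  | succ t ht _ =>
    rw [stateAt_succ_of_le ports pick ω ht (by omega)] at hv ⊢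
    rw [← own_stateAt ports pick ω t v] at hv
    simp only [receiveWin] at hv ⊢
    exact Finset.sum_eq_zero fun y _ => if_neg fun h => h.2 (h.1.trans hv.symm)

/-- Number of notifications for the rank `r` of `u` that have reached `u` or are on their way. -/
noncomputable def winTotal (r : Rank n) (u : V) (t : ℕ) : ℕ :=
  (stateAt ports pick ω t u).wins + ∑ v, pendingOf r (stateAt ports pick ω t v)

section Unique

variable {u : V} {r : Rank n} (hu : ownRank (ω u) = r) (huniq : ∀ v, ownRank (ω v) = r → v = u)

include hu huniq

theorem winTotal_succ_eq_sum_heldOf :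
    winTotal ports pick ω r u (T + 1) = ∑ v, heldOf r (stateAt ports pick ω (T + 1) v) := by
  have hcl : ∀ v, (stateAt ports pick ω T v).clock = T :=
    fun v => clock_stateAt ports pick ω (by omega) v
  have hw : ∀ v, (stateAt ports pick ω (T + 1) v).wins =
      if ownRank (ω v) = (stateAt ports pick ω (T + 1) v).best
        then (stateAt ports pick ω (T + 1) v).held else 0 := by
    intro v
    rw [stateAt_succ_of_lt ports pick ω (by omega), ← own_stateAt ports pick ω T v]
    simp [receiveToken, hcl]
  have hp : ∀ v, (stateAt ports pick ω (T + 1) v).pending =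
      if ownRank (ω v) ≠ (stateAt ports pick ω (T + 1) v).best
        then (stateAt ports pick ω (T + 1) v).held else 0 := by
    intro v
    rw [stateAt_succ_of_lt ports pick ω (by omega), ← own_stateAt ports pick ω T v]
    simp [receiveToken, hcl]
  have hsingle : (stateAt ports pick ω (T + 1) u).wins =
      ∑ v, if v = u then (stateAt ports pick ω (T + 1) v).wins else 0 := by simp
  rw [winTotal, hsingle, ← Finset.sum_add_distrib]
  refine Finset.sum_congr rfl fun v _ => ?_
  unfold pendingOf heldOf
  rw [hw, hp]
  by_cases hv : v = u
  · subst hv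
    rw [hu]
    by_cases hb : (stateAt ports pick ω (T + 1) v).best = r
    · simp [hb]
    · simp [hb, Ne.symm hb]
  · have : ownRank (ω v) ≠ r := fun h => hv (huniq v h)
    by_cases hb : (stateAt ports pick ω (T + 1) v).best = r
    · simp [hb, hv, this]
    · simp [hb, hv]

theorem winTotal_succ {t : ℕ} (ht : T + 1 ≤ t) (ht' : t < 2 * (T + 1)) :
    winTotal ports pick ω r u (t + 1) = (stateAt ports pick ω t u).wins +
      ∑ w, ∑ x, if (ports w x : V) = u ∨ (stateAt ports pick ω t (ports w x)).best = r then
        (if (stateAt ports pick ω t w).origin = some x then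
          pendingOf r (stateAt ports pick ω t w) else 0) else 0 := by
  have hsend : ∀ w x, (if (stateAt ports pick ω t w).origin = some x then
        pendingOf r (stateAt ports pick ω t w) else 0) =
      winsOf r (send n T _ (ω w) (stateAt ports pick ω t w) x) := by
    intro w x
    rw [winsOf_send] <;> rw [clock_stateAt ports pick ω (by omega)] <;> omega
  simp_rw [hsend]
  rw [← sum_reversePort ports fun v w x =>
    if v = u ∨ (stateAt ports pick ω t v).best = r then
        winsOf r (send n T _ (ω w) (stateAt ports pick ω t w) x) else 0]
  have hw : (stateAt ports pick ω (t + 1) u).wins = (stateAt ports pick ω t u).wins +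
      ∑ y, winsOf r (inboxAt ports pick ω t u y) := by
    rw [stateAt_succ_of_le ports pick ω ht ht']
    simp only [receiveWin, own_stateAt, hu]
    rfl
  have hsingle : ∑ y, winsOf r (inboxAt ports pick ω t u y) =
      ∑ v, if v = u then ∑ y, winsOf r (inboxAt ports pick ω t v y) else 0 := by simp
  rw [winTotal, hw, hsingle, add_assoc, ← Finset.sum_add_distrib]
  congr 1
  refine Finset.sum_congr rfl fun v _ => ?_
  have hp : pendingOf r (stateAt ports pick ω (t + 1) v) =
      if (stateAt ports pick ω t v).best = r ∧ v ≠ u then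
        ∑ y, winsOf r (inboxAt ports pick ω t v y) else 0 := by
    by_cases hv : v = u
    · subst hv
      unfold pendingOf
      split_ifs with h1 h2
      · exact absurd rfl h2.2
      · exact pending_eq_zero_of_best_eq ports pick ω (by omega) (by omega) (hu.trans h1.symm)
      · tauto
      · rfl
    · have hown : ownRank (ω v) ≠ r := fun h => hv (huniq v h)
      rw [stateAt_succ_of_le ports pick ω ht ht', pendingOf]
      simp only [receiveWin, own_stateAt]
      by_cases hb : (stateAt ports pick ω t v).best = r
      · rw [if_pos hb, if_pos ⟨hb, hv⟩]
        refine Finset.sum_congr rfl fun y _ => ?_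
        rw [hb, winsOf]
        by_cases hy : winRank (inboxAt ports pick ω t v y) = r
        · rw [if_pos ⟨hy, hy ▸ hown.symm⟩, if_pos hy]
        · rw [if_neg fun h => hy h.1, if_neg hy]
      · rw [if_neg hb, if_neg fun h => hb h.1]
  rw [hp]
  by_cases hv : v = u
  · simp [hv, inboxAt]
  · by_cases hb : (stateAt ports pick ω t v).best = r <;> simp [hv, hb, inboxAt]

theorem winTotal_le {t : ℕ} (ht : T + 1 ≤ t) (ht' : t ≤ 2 * (T + 1)) :
    winTotal ports pick ω r u t ≤ ∑ v, heldOf r (stateAt ports pick ω (T + 1) v) := by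
  induction t, ht using Nat.le_induction with
  | base => exact (winTotal_succ_eq_sum_heldOf ports pick ω hu huniq).le
  | succ t ht ih =>
    refine le_trans ?_ (ih (by omega))
    rw [winTotal_succ ports pick ω hu huniq ht (by omega), winTotal]
    refine Nat.add_le_add_left (Finset.sum_le_sum fun w _ => ?_) _
    calc _ ≤ ∑ x, (if (stateAt ports pick ω t w).origin = some x then
          pendingOf r (stateAt ports pick ω t w) else 0) :=
          Finset.sum_le_sum fun x _ => by split_ifs <;> simp
      _ ≤ pendingOf r (stateAt ports pick ω t w) := by
          cases (stateAt ports pick ω t w).origin <;> simp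

/-- If `u` gets all notifications then none of its tokens has been discarded. -/
theorem walkCount_eq_heldOf_of_wins (hn : 0 < n)
    (hwins : (stateAt ports pick ω (2 * (T + 1)) u).wins = numTokens n) (v : V) :
    walkCount ports ω r u (T + 1) v = heldOf r (stateAt ports pick ω (T + 1) v) := by
  have h1 := winTotal_le ports pick ω hu huniq (show T + 1 ≤ 2 * (T + 1) by omega) le_rfl
  have h2 : numTokens n ≤ ∑ v, heldOf r (stateAt ports pick ω (T + 1) v) := by
    rw [← hwins]; exact (Nat.le_add_right _ _).trans h1
  have h3 : ∀ v ∈ Finset.univ, heldOf r (stateAt ports pick ω (T + 1) v) ≤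
      walkCount ports ω r u (T + 1) v :=
    fun v _ => heldOf_le_walkCount ports pick ω hu huniq le_rfl v
  rw [← sum_walkCount ports ω r u hn le_rfl] at h2
  exact ((Finset.sum_eq_sum_iff_of_le h3).1 (le_antisymm (Finset.sum_le_sum h3) h2) v
    (Finset.mem_univ v)).symm

/-- The candidate of largest rank gets all notifications. -/
theorem wins_eq_numTokens (hmax : ∀ v, ownRank (ω v) ≤ r) (hn : 0 < n) :
    (stateAt ports pick ω (2 * (T + 1)) u).wins = numTokens n := by
  obtain ⟨L, hL, hO⟩ := exists_level ports pick ω hu huniq hmax (le_refl (T + 1))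
  have key : ∀ s ≤ T + 1, winTotal ports pick ω r u (T + 1 + s) = numTokens n ∧
      ∀ v, 0 < pendingOf r (stateAt ports pick ω (T + 1 + s) v) → L v + s ≤ T + 1 := by
    intro s
    induction s with
    | zero =>
      refine fun _ => ⟨?_, fun v hv => hL v ?_⟩
      · rw [add_zero, winTotal_succ_eq_sum_heldOf ports pick ω hu huniq]
        simp_rw [heldOf_eq_walkCount ports pick ω hu huniq hmax le_rfl]
        exact sum_walkCount ports ω r u hn le_rfl
      · by_contra hb
        simp [pendingOf, hb] at hv
    | succ s ih =>
      intro hs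
      obtain ⟨ih1, ih2⟩ := ih (by omega)
      have hbo := best_origin_stateAt_of_le ports pick ω (show T + 1 ≤ T + 1 + s by omega)
        (by omega)
      have hnext : ∀ w, 0 < pendingOf r (stateAt ports pick ω (T + 1 + s) w) → ∃ x,
          (stateAt ports pick ω (T + 1 + s) w).origin = some x ∧
          (stateAt ports pick ω (T + 1 + s) (ports w x)).best = r ∧ L (ports w x) < L w := by
        intro w hw
        have hb : (stateAt ports pick ω (T + 1 + s) w).best = r := by
          by_contra hb
          simp [pendingOf, hb] at hw
        have hne : w ≠ u := by
          rintro rfl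
          rw [pendingOf, if_pos hb, pending_eq_zero_of_best_eq ports pick ω (by omega) (by omega)
            (hu.trans hb.symm)] at hw
          exact lt_irrefl _ hw
        obtain ⟨x, h1, h2, h3⟩ := hO w hne (by rw [← (hbo w).1, hb])
        exact ⟨x, by rw [(hbo w).2, h1], by rw [(hbo _).1, h2], h3⟩
      refine ⟨?_, fun v hv => ?_⟩
      · rw [← ih1, ← add_assoc, winTotal_succ ports pick ω hu huniq (by omega) (by omega), winTotal]
        congr 1
        refine Finset.sum_congr rfl fun w _ => ?_
        rcases Nat.eq_zero_or_pos (pendingOf r (stateAt ports pick ω (T + 1 + s) w)) with h0 | h0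
        · simp [h0]
        · obtain ⟨x, h1, h2, -⟩ := hnext w h0
          rw [Finset.sum_eq_single x]
          · rw [if_pos (Or.inr h2), if_pos h1]
          · intro x' _ hx'
            have : (stateAt ports pick ω (T + 1 + s) w).origin ≠ some x' := by
              rw [h1]; simpa using hx'.symm
            simp [this]
          · simp
      · have hb : (stateAt ports pick ω (T + 1 + (s + 1)) v).best = r := by
          by_contra hb
          simp [pendingOf, hb] at hv
        rw [pendingOf, if_pos hb] at hv
        rw [← add_assoc] at hb hv
        rw [stateAt_succ_of_le ports pick ω (by omega) (by omega)] at hv hb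
        simp only [receiveWin] at hv
        obtain ⟨y, -, hy⟩ := Finset.exists_ne_zero_of_sum_ne_zero hv.ne'
        have hbv : (stateAt ports pick ω (T + 1 + s) v).best = r := hb
        have hwr : winsOf r (inboxAt ports pick ω (T + 1 + s) v y) ≠ 0 := by
          simp only [hbv] at hy
          rw [Ne, ite_eq_right_iff, Classical.not_imp] at hy
          rw [winsOf, if_pos hy.1.1]
          exact hy.2
        rw [inboxAt, winsOf_send _ _ _ (by rw [clock_stateAt ports pick ω (by omega)]; omega)
          (by rw [clock_stateAt ports pick ω (by omega)]; omega)] at hwr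
        split_ifs at hwr with ho
        · obtain ⟨x, h1, -, h3⟩ := hnext _ (Nat.pos_of_ne_zero hwr)
          rw [h1, Option.some_inj] at ho
          rw [ho, ports_backPort] at h3
          have := ih2 _ (Nat.pos_of_ne_zero hwr)
          omega
        · exact absurd rfl hwr
  obtain ⟨h1, h2⟩ := key (T + 1) le_rfl
  rw [← two_mul] at h1 h2
  have h0 : ∀ v, pendingOf r (stateAt ports pick ω (2 * (T + 1)) v) = 0 := by
    intro v
    by_contra hv
    have hLv := h2 v (Nat.pos_of_ne_zero hv)
    have hb : (stateAt ports pick ω (2 * (T + 1)) v).best = r := by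
      by_contra hb
      simp [pendingOf, hb] at hv
    by_cases hvu : v = u
    · subst hvu
      rw [pendingOf, if_pos hb] at hv
      exact hv (pending_eq_zero_of_best_eq ports pick ω (by omega) le_rfl (hu.trans hb.symm))
    · obtain ⟨x, -, -, h3⟩ := hO v hvu
        (by rw [← (best_origin_stateAt_of_le ports pick ω (by omega) le_rfl v).1, hb])
      omega
  simpa [winTotal, h0] using h1

end Unique

/-! ### Election of the candidate of largest rank -/

theorem status_stateAt (v : V) : (stateAt ports pick ω (2 * (T + 1)) v).status =
    if ownRank (ω v) ≠ ⊥ ∧ (stateAt ports pick ω (2 * (T + 1)) v).wins = numTokens n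
      then Status.elected else Status.nonElected := by
  have h : 2 * (T + 1) = 2 * T + 1 + 1 := by ring
  rw [h, stateAt_succ_of_le ports pick ω (by omega) (by omega)]
  have hcl := clock_stateAt ports pick ω (show 2 * T + 1 ≤ 2 * (T + 1) by omega) v
  simp only [receiveWin, own_stateAt, hcl, if_true]

/-- Coins for which the election succeeds: there is a candidate, the candidates have different
ranks, and the undisturbed walks of any two candidates meet at their end. -/
structure Good : Prop where
  exists_candidate : ∃ v, (ω v).1 = true
  rank_injOn : ∀ u v, (ω u).1 = true → (ω v).1 = true → (ω u).2.1 = (ω v).2.1 → u = v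
  meet : ∀ u v, (ω u).1 = true → (ω v).1 = true → u ≠ v →
    ∃ w, 0 < walkCount ports ω (ω u).2.1 u (T + 1) w ∧ 0 < walkCount ports ω (ω v).2.1 v (T + 1) w

theorem ownRank_eq_coe {d : ℕ} {c : Coins n T d} {r : Rank n} :
    ownRank c = r ↔ c.1 = true ∧ c.2.1 = r := by
  unfold ownRank
  split_ifs with h <;> simp [h]

theorem Good.leaderAt {ω : (v : V) → Coins n T (G.degree v)} (hω : Good ports ω) (hn : 0 < n)
    {t : ℕ} (ht : 2 * (T + 1) ≤ t) : (algorithm n T pick).LeaderAt ports ω t := by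
  have hst : ∀ v, (algorithm n T pick).status _ ((algorithm n T pick).run ports ω t v) =
      if ownRank (ω v) ≠ ⊥ ∧ (stateAt ports pick ω (2 * (T + 1)) v).wins = numTokens n
      then Status.elected else Status.nonElected := by
    intro v
    rw [← status_stateAt, ← stateAt_of_two_mul_le ports pick ω ht]
    rfl
  obtain ⟨v₀, hv₀⟩ := hω.exists_candidate
  obtain ⟨u, -, hmax⟩ := Finset.exists_max_image Finset.univ (fun v => ownRank (ω v))
    ⟨v₀, Finset.mem_univ _⟩
  have hmax : ∀ v, ownRank (ω v) ≤ ownRank (ω u) := fun v => hmax v (Finset.mem_univ v)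
  have hcand : (ω u).1 = true := by
    by_contra h
    have := hmax v₀
    simp [ownRank, h, hv₀] at this
  have hown : ∀ v, (ω v).1 = true → ownRank (ω v) = (ω v).2.1 :=
    fun v hv => ownRank_eq_coe.2 ⟨hv, rfl⟩
  have huniq : ∀ v, (ω v).1 = true → ∀ w, ownRank (ω w) = (ω v).2.1 → w = v := fun v hv w hw =>
    have h := ownRank_eq_coe.1 hw
    hω.rank_injOn w v h.1 hv h.2
  rw [hown u hcand] at hmax
  refine ⟨u, ?_, fun v hv => ?_⟩
  · rw [hst, if_pos]
    refine ⟨by simp [hown u hcand], ?_⟩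
    exact wins_eq_numTokens ports pick ω (hown u hcand) (huniq u hcand) hmax hn
  · rw [hst, if_neg]
    rintro ⟨h1, h2⟩
    have hvc : (ω v).1 = true := by
      by_contra h
      simp [ownRank, h] at h1
    obtain ⟨w, hw1, hw2⟩ := hω.meet u v hcand hvc hv.symm
    rw [walkCount_eq_heldOf_of_wins ports pick ω (hown v hvc) (huniq v hvc) hn h2] at hw2
    rw [← heldOf_eq_walkCount ports pick ω (hown u hcand) (huniq u hcand) hmax le_rfl] at hw1
    have hb1 : (stateAt ports pick ω (T + 1) w).best = (ω u).2.1 := by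
      by_contra hb; simp [heldOf, hb] at hw1
    have hb2 : (stateAt ports pick ω (T + 1) w).best = (ω v).2.1 := by
      by_contra hb; simp [heldOf, hb] at hw2
    exact hv (hω.rank_injOn v u hvc hcand (WithBot.coe_injective (hb2.symm.trans hb1)))

end Correctness

end Election

namespace Election

/-! ### Expectations over the coins of all nodes -/

section Coins

/-- Probability of being a candidate. -/
noncomputable def candProb (n : ℕ) : ℝ := 2 * Real.log n / n

theorem candProb_nonneg (n : ℕ) : 0 ≤ candProb n := by
  have := Real.log_natCast_nonneg n
  unfold candProb
  positivity

theorem candProb_lt_one {n : ℕ} (hn : 0 < n) : candProb n < 1 := by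
  have hn' : (0 : ℝ) < n := by exact_mod_cast hn
  have h1 : Real.log (n / 2) ≤ n / 2 - 1 := Real.log_le_sub_one_of_pos (by positivity)
  rw [Real.log_div hn'.ne' (by norm_num)] at h1
  have h2 := Real.log_two_lt_d9
  rw [candProb, div_lt_one hn']
  linarith

variable {n T d : ℕ}

/-- Probability of the coins of a node. -/
noncomputable def coinWeight (c : Coins n T d) : ℝ :=
  (if c.1 then candProb n else 1 - candProb n) * (((n : ℝ) ^ 4)⁻¹ *
    ∏ _i : Fin (T + 1) × Rank n × Fin (n * numTokens n), (d : ℝ)⁻¹)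

theorem coinWeight_nonneg (hn : 0 < n) (c : Coins n T d) : 0 ≤ coinWeight c := by
  have h0 := candProb_nonneg n
  have h1 := (candProb_lt_one hn).le
  refine mul_nonneg ?_ (by positivity)
  split_ifs
  · exact h0
  · linarith

theorem sum_coinWeight_mul (a : Bool → ℝ) (b : Rank n → ℝ)
    (h : Fin (T + 1) × Rank n × Fin (n * numTokens n) → Fin d → ℝ) :
    ∑ c : Coins n T d, coinWeight c * (a c.1 * (b c.2.1 * ∏ i, h i (c.2.2 i))) =
      (candProb n * a true + (1 - candProb n) * a false) *
        ((((n : ℝ) ^ 4)⁻¹ * ∑ r, b r) * ∏ i, ((d : ℝ)⁻¹ * ∑ x, h i x)) := by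
  have h1 : ∏ i, ((d : ℝ)⁻¹ * ∑ x, h i x) =
      ∑ σ : Fin (T + 1) × Rank n × Fin (n * numTokens n) → Fin d,
        ∏ i, ((d : ℝ)⁻¹ * h i (σ i)) := by
    simp_rw [Finset.mul_sum]
    rw [Finset.prod_univ_sum]
    simp
  have h2 : candProb n * a true + (1 - candProb n) * a false =
      ∑ b : Bool, (if b then candProb n else 1 - candProb n) * a b := by simp
  rw [h1, h2, Finset.sum_mul, Fintype.sum_prod_type]
  refine Finset.sum_congr rfl fun x _ => ?_
  rw [Fintype.sum_prod_type, Finset.mul_sum (f := b), Finset.sum_mul_sum, Finset.mul_sum]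
  refine Finset.sum_congr rfl fun r _ => ?_
  rw [Finset.mul_sum]
  refine Finset.sum_congr rfl fun σ _ => ?_
  simp only [coinWeight, Finset.prod_mul_distrib]
  ring

theorem card_rank (n : ℕ) : Fintype.card (Rank n) = n ^ 4 := by
  rw [Fintype.card_ofFinset]
  simp

end Coins

section Expectation

variable {V : Type*} [Fintype V] [DecidableEq V] {G : SimpleGraph V} [DecidableRel G.Adj]
  {n T : ℕ}

/-- Coins of all nodes. -/
abbrev Outcomes {V : Type*} [Fintype V] (G : SimpleGraph V) [DecidableRel G.Adj] (n T : ℕ) :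
    Type _ :=
  (v : V) → Coins n T (G.degree v)

/-- Probability of the coins of all nodes. -/
noncomputable def outcomeWeight (ω : Outcomes G n T) : ℝ :=
  ∏ v, coinWeight (ω v)

/-- Expectation over the coins of all nodes. -/
noncomputable def expect (F : Outcomes G n T → ℝ) : ℝ :=
  ∑ ω, outcomeWeight ω * F ω

theorem outcomeWeight_nonneg (hn : 0 < n) (ω : Outcomes G n T) :
    0 ≤ outcomeWeight ω :=
  Finset.prod_nonneg fun _ _ => coinWeight_nonneg hn _

theorem expect_mono (hn : 0 < n) {F F' : Outcomes G n T → ℝ}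
    (h : ∀ ω, F ω ≤ F' ω) : expect F ≤ expect F' :=
  Finset.sum_le_sum fun ω _ => mul_le_mul_of_nonneg_left (h ω) (outcomeWeight_nonneg hn ω)

theorem expect_sum {ι : Type*} (s : Finset ι)
    (F : ι → Outcomes G n T → ℝ) :
    expect (fun ω => ∑ i ∈ s, F i ω) = ∑ i ∈ s, expect (F i) := by
  unfold expect
  simp_rw [Finset.mul_sum]
  exact Finset.sum_comm

theorem expect_add (F F' : Outcomes G n T → ℝ) :
    expect (fun ω => F ω + F' ω) = expect F + expect F' := by
  unfold expect
  simp_rw [mul_add, Finset.sum_add_distrib]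

theorem expect_mul_left (a : ℝ) (F : Outcomes G n T → ℝ) :
    expect (fun ω => a * F ω) = a * expect F := by
  unfold expect
  rw [Finset.mul_sum]
  exact Finset.sum_congr rfl fun ω _ => by ring

theorem expect_prod (g : (v : V) → Coins n T (G.degree v) → ℝ) :
    expect (fun ω => ∏ v, g v (ω v)) = ∏ v, ∑ c, coinWeight c * g v c := by
  rw [Finset.prod_univ_sum]
  simp [expect, outcomeWeight, Finset.prod_mul_distrib]

/-- Expectation of a product of functions of the single coins. -/
theorem expect_prod_coins (a : V → Bool → ℝ) (b : V → Rank n → ℝ)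
    (h : (v : V) → Fin (T + 1) × Rank n × Fin (n * numTokens n) → Fin (G.degree v) → ℝ) :
    expect (fun ω : Outcomes G n T =>
        ∏ v, (a v (ω v).1 * (b v (ω v).2.1 * ∏ i, h v i ((ω v).2.2 i)))) =
      ∏ v, (candProb n * a v true + (1 - candProb n) * a v false) *
        ((((n : ℝ) ^ 4)⁻¹ * ∑ r, b v r) * ∏ i, ((G.degree v : ℝ)⁻¹ * ∑ x, h v i x)) := by
  rw [expect_prod fun v c => a v c.1 * (b v c.2.1 * ∏ i, h v i (c.2.2 i))]
  exact Finset.prod_congr rfl fun v _ => sum_coinWeight_mul (a v) (b v) (h v)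

section Positive

variable (hn : 0 < n) (hdeg : ∀ v, 0 < G.degree v)

include hn

theorem inv_mul_sum_rank_one : ((n : ℝ) ^ 4)⁻¹ * ∑ _r : Rank n, (1 : ℝ) = 1 := by
  have : (n : ℝ) ≠ 0 := by exact_mod_cast hn.ne'
  rw [Finset.sum_const, Finset.card_univ, card_rank]
  simp
  field_simp

include hdeg

theorem inv_mul_sum_port_one (v : V) :
    ((G.degree v : ℝ)⁻¹ * ∑ _x : Fin (G.degree v), (1 : ℝ)) = 1 := by
  have : (G.degree v : ℝ) ≠ 0 := by exact_mod_cast (hdeg v).ne'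
  simp
  field_simp

theorem expect_prod_basic (a : V → Bool → ℝ) (b : V → Rank n → ℝ) :
    expect (fun ω : Outcomes G n T =>
        ∏ v, (a v (ω v).1 * b v (ω v).2.1)) =
      ∏ v, ((candProb n * a v true + (1 - candProb n) * a v false) *
        (((n : ℝ) ^ 4)⁻¹ * ∑ r, b v r)) := by
  have := expect_prod_coins (G := G) (T := T) a b fun _ _ _ => 1
  simpa only [inv_mul_sum_port_one hn hdeg, Finset.prod_const_one, mul_one] using this

theorem expect_prod_cand (a : V → Bool → ℝ) :
    expect (fun ω : Outcomes G n T => ∏ v, a v (ω v).1) =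
      ∏ v, (candProb n * a v true + (1 - candProb n) * a v false) := by
  have := expect_prod_basic (T := T) hn hdeg a fun _ _ => 1
  simpa only [inv_mul_sum_rank_one hn, mul_one] using this

theorem expect_prod_port
    (h : (v : V) → Fin (T + 1) × Rank n × Fin (n * numTokens n) → Fin (G.degree v) → ℝ) :
    expect (fun ω : Outcomes G n T => ∏ v, ∏ i, h v i ((ω v).2.2 i)) =
      ∏ v, ∏ i, ((G.degree v : ℝ)⁻¹ * ∑ x, h v i x) := by
  have := expect_prod_coins (G := G) (T := T) (fun _ _ => 1) (fun _ _ => 1) h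
  simpa only [inv_mul_sum_rank_one hn, mul_one, one_mul, add_sub_cancel] using this

theorem expect_const (a : ℝ) :
    expect (fun _ : Outcomes G n T => a) = a := by
  have := expect_prod_cand (T := T) hn hdeg fun (_ : V) _ => 1
  simp only [mul_one, add_sub_cancel, Finset.prod_const_one] at this
  have h := expect_mul_left a fun _ : Outcomes G n T => 1
  rw [this] at h
  simpa using h

/-- Fubini's theorem: if `Φ ω ω'` depends on `ω` only outside the ports with index in `A`, and on
`ω'` only through the ports with index in `A`, then the two arguments are independent. -/
theorem expect_diag (A : Set (Fin (T + 1) × Rank n × Fin (n * numTokens n)))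
    (Φ : Outcomes G n T → Outcomes G n T → ℝ)
    (h1 : ∀ ω₁ ω₂ ω', (∀ v, (ω₁ v).1 = (ω₂ v).1 ∧ (ω₁ v).2.1 = (ω₂ v).2.1 ∧
      ∀ i ∉ A, (ω₁ v).2.2 i = (ω₂ v).2.2 i) → Φ ω₁ ω' = Φ ω₂ ω')
    (h2 : ∀ ω ω₁ ω₂, (∀ v, ∀ i ∈ A, (ω₁ v).2.2 i = (ω₂ v).2.2 i) → Φ ω ω₁ = Φ ω ω₂) :
    expect (fun ω => Φ ω ω) = expect fun ω => expect (Φ ω) := by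
  classical
  let instOutcomes : Fintype (Outcomes G n T) := inferInstance
  let mix : Outcomes G n T → Outcomes G n T → Outcomes G n T := fun ω ω' v =>
    ((ω v).1, (ω v).2.1, fun i => if i ∈ A then (ω' v).2.2 i else (ω v).2.2 i)
  have hinv : Function.Involutive fun p : Outcomes G n T × Outcomes G n T =>
      (mix p.1 p.2, mix p.2 p.1) := by
    rintro ⟨ω, ω'⟩
    ext v i <;> simp [mix] <;> split_ifs <;> rfl
  have hw : ∀ ω ω' : Outcomes G n T, outcomeWeight (mix ω ω') = outcomeWeight ω := fun _ _ => rfl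
  have hΦ : ∀ ω ω' : Outcomes G n T, Φ ω ω' = Φ (mix ω ω') (mix ω ω') := by
    intro ω ω'
    rw [h1 ω (mix ω ω') ω' fun v => ⟨rfl, rfl, fun i hi => by simp [mix, hi]⟩,
      h2 (mix ω ω') ω' (mix ω ω') fun v i hi => by simp [mix, hi]]
  have hone : ∑ ω' : Outcomes G n T, outcomeWeight ω' = 1 := by
    simpa [expect] using expect_const (T := T) hn hdeg (1 : ℝ)
  symm
  calc expect (fun ω => expect (Φ ω))
      = ∑ p : Outcomes G n T × Outcomes G n T,
          outcomeWeight p.1 * (outcomeWeight p.2 * Φ p.1 p.2) := by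
        rw [Fintype.sum_prod_type]
        simp_rw [← Finset.mul_sum]
        rfl
    _ = ∑ p : Outcomes G n T × Outcomes G n T, outcomeWeight (mix p.1 p.2) *
          (outcomeWeight (mix p.2 p.1) * Φ (mix p.1 p.2) (mix p.1 p.2)) := by
        refine Finset.sum_congr rfl fun p _ => ?_
        rw [hw, hw, ← hΦ]
    _ = ∑ p : Outcomes G n T × Outcomes G n T,
          outcomeWeight p.1 * (outcomeWeight p.2 * Φ p.1 p.1) :=
        Equiv.sum_comp hinv.toPerm fun p : Outcomes G n T × Outcomes G n T =>
          outcomeWeight p.1 * (outcomeWeight p.2 * Φ p.1 p.1)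
    _ = expect fun ω => Φ ω ω := by
        rw [Fintype.sum_prod_type]
        simp_rw [← Finset.mul_sum, ← Finset.sum_mul, hone, one_mul]
        rfl

end Positive

end Expectation

/-! ### The law of the coins -/

section Law

theorem isProbabilityMeasure_candidateLaw {n : ℕ} (hn : 0 < n) :
    IsProbabilityMeasure (candidateLaw n) := by
  constructor
  have h0 := candProb_nonneg n
  have h1 := (candProb_lt_one hn).le
  simp only [candProb] at h0 h1
  simp only [candidateLaw, Measure.coe_add, Measure.coe_smul, Pi.add_apply, Pi.smul_apply,
    measure_univ, smul_eq_mul, mul_one]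
  rw [← ENNReal.ofReal_add h0 (by linarith)]
  simp

theorem isProbabilityMeasure_coinLaw {n T d : ℕ} (hn : 0 < n) (hd : 0 < d) :
    IsProbabilityMeasure (coinLaw n T d) := by
  have := isProbabilityMeasure_candidateLaw hn
  have : Nonempty (Fin d) := ⟨⟨0, hd⟩⟩
  have : Nonempty (Rank n) := ⟨⟨1, le_rfl, Nat.one_le_pow _ _ hn⟩⟩
  unfold coinLaw
  infer_instance

theorem coinLaw_singleton {n T d : ℕ} (hn : 0 < n) (hd : 0 < d) (c : Coins n T d) :
    (coinLaw n T d).real {c} = coinWeight c := by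
  have := isProbabilityMeasure_candidateLaw hn
  have : Nonempty (Fin d) := ⟨⟨0, hd⟩⟩
  have : Nonempty (Rank n) := ⟨⟨1, le_rfl, Nat.one_le_pow _ _ hn⟩⟩
  have h0 := candProb_nonneg n
  have h1 := (candProb_lt_one hn).le
  obtain ⟨b, r, σ⟩ := c
  rw [coinLaw, measureReal_def, ← Set.singleton_prod_singleton, Measure.prod_prod,
    ← Set.singleton_prod_singleton, Measure.prod_prod, Measure.pi_singleton, coinWeight]
  simp only [ENNReal.toReal_mul, ENNReal.toReal_prod]
  congr 1
  · simp only [candProb] at h0 h1 ⊢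
    cases b
    · simp [candidateLaw, h1]
    · simp [candidateLaw, h0]
  · congr 1
    · simp [ProbabilityTheory.uniformOn_univ]
    · refine Finset.prod_congr rfl fun i _ => ?_
      simp [ProbabilityTheory.uniformOn_univ]

variable {V : Type*} [Fintype V] [DecidableEq V] {G : SimpleGraph V} [DecidableRel G.Adj]
  {n T : ℕ}

theorem prob_real_eq_expect (hn : 0 < n) (hdeg : ∀ v, 0 < G.degree v) (pick : PortChoice)
    (S : Set (Outcomes G n T)) :
    ((algorithm n T pick).prob G).real S = expect (S.indicator fun _ => 1) := by
  classical
  have hp : ∀ v, IsProbabilityMeasure (coinLaw n T (G.degree v)) :=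
    fun v => isProbabilityMeasure_coinLaw hn (hdeg v)
  change (Measure.pi fun v => coinLaw n T (G.degree v)).real S = _
  have hS : S = ((Finset.univ.filter (· ∈ S) : Finset (Outcomes G n T)) :
      Set (Outcomes G n T)) := by ext; simp
  conv_lhs => rw [hS]
  rw [← sum_measureReal_singleton, Finset.sum_filter, expect]
  refine Finset.sum_congr rfl fun ω _ => ?_
  by_cases h : ω ∈ S
  · rw [if_pos h, Set.indicator_of_mem h, mul_one, measureReal_def, Measure.pi_singleton,
      ENNReal.toReal_prod, outcomeWeight]
    exact Finset.prod_congr rfl fun v _ => coinLaw_singleton hn (hdeg v) (ω v)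
  · rw [if_neg h, Set.indicator_of_notMem h, mul_zero]

end Law

end Election

namespace Election

/-! ### Generating function of the undisturbed walks -/

section GeneratingFunction

theorem prod_pow_sampleCount {n T d : ℕ} (c : Coins n T d) (t : Fin (T + 1)) (r : Rank n) (k : ℕ)
    (a : Fin d → ℝ) : ∏ x, a x ^ sampleCount c t r k x =
      ∏ j : Fin (n * numTokens n), if j.1 < k then a (c.2.2 (t, r, j)) else 1 := by
  rw [← Finset.prod_filter, ← Finset.prod_fiberwise _ fun j => c.2.2 (t, r, j)]
  refine Finset.prod_congr rfl fun x _ => ?_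
  rw [sampleCount, Finset.filter_filter, ← Finset.prod_const]
  refine Finset.prod_congr rfl fun j hj => ?_
  rw [(Finset.mem_filter.1 hj).2.2]

theorem prod_index {n T : ℕ} (t : Fin (T + 1)) (r : Rank n) (k : ℕ)
    (b : Fin (n * numTokens n) → ℝ) :
    ∏ i : Fin (T + 1) × Rank n × Fin (n * numTokens n),
      (if i.1 = t ∧ i.2.1 = r ∧ i.2.2.1 < k then b i.2.2 else 1) =
      ∏ j : Fin (n * numTokens n), if j.1 < k then b j else 1 := by
  rw [Fintype.prod_prod_type, Finset.prod_eq_single t, Fintype.prod_prod_type,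
    Finset.prod_eq_single r]
  · simp
  · intro r' _ hr'
    simp [hr']
  · simp
  · intro t' _ ht'
    simp [ht']
  · simp

variable {V : Type*} [Fintype V] [DecidableEq V] {G : SimpleGraph V} [DecidableRel G.Adj]
  (ports : PortNumbering G) {n T : ℕ}

theorem inv_degree_mul_sum_ports (f : V → ℝ) (w : V) :
    (G.degree w : ℝ)⁻¹ * ∑ x, f (ports w x) = (transitionMatrix G).mulVec f w := by
  rw [Equiv.sum_comp (ports w) fun z : G.neighborSet w => f z]
  simp only [Matrix.mulVec, dotProduct, transitionMatrix, ite_mul, zero_mul]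
  rw [← Finset.sum_filter, Finset.mul_sum, ← SimpleGraph.neighborFinset_eq_filter]
  rw [← Finset.sum_subtype (G.neighborFinset w) (p := fun z => z ∈ G.neighborSet w)
    (by simp) fun z => (G.degree w : ℝ)⁻¹ * f z]
  simp

variable (hn : 0 < n) (hdeg : ∀ v, 0 < G.degree v)

include hn hdeg

theorem expect_prod_samples (f : V → ℝ) (t : Fin (T + 1)) (r : Rank n) (k : V → ℕ)
    (hk : ∀ v, k v ≤ n * numTokens n) :
    expect (fun ω : Outcomes G n T => ∏ w, ∏ j : Fin (n * numTokens n),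
      if j.1 < k w then f (ports w ((ω w).2.2 (t, r, j))) else 1) =
      ∏ w, (transitionMatrix G).mulVec f w ^ k w := by
  have h := expect_prod_port (T := T) hn hdeg fun w i x =>
    if i.1 = t ∧ i.2.1 = r ∧ i.2.2.1 < k w then f (ports w x) else 1
  have h1 : ∀ ω : Outcomes G n T, (∏ w, ∏ j : Fin (n * numTokens n),
        if j.1 < k w then f (ports w ((ω w).2.2 (t, r, j))) else 1) =
      ∏ w, ∏ i : Fin (T + 1) × Rank n × Fin (n * numTokens n),
        if i.1 = t ∧ i.2.1 = r ∧ i.2.2.1 < k w then f (ports w ((ω w).2.2 i)) else 1 := by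
    intro ω
    refine Finset.prod_congr rfl fun w _ => ?_
    rw [← prod_index t r (k w) fun j => f (ports w ((ω w).2.2 (t, r, j)))]
    refine Finset.prod_congr rfl fun i _ => ?_
    by_cases hi : i.1 = t ∧ i.2.1 = r ∧ i.2.2.1 < k w
    · rw [if_pos hi, if_pos hi, ← hi.1, ← hi.2.1]
    · rw [if_neg hi, if_neg hi]
  simp_rw [h1]
  rw [h]
  refine Finset.prod_congr rfl fun w _ => ?_
  have h2 : ∀ i : Fin (T + 1) × Rank n × Fin (n * numTokens n),
      ((G.degree w : ℝ)⁻¹ * ∑ x,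
        if i.1 = t ∧ i.2.1 = r ∧ i.2.2.1 < k w then f (ports w x) else 1) =
      if i.1 = t ∧ i.2.1 = r ∧ i.2.2.1 < k w then (transitionMatrix G).mulVec f w else 1 := by
    intro i
    by_cases hi : i.1 = t ∧ i.2.1 = r ∧ i.2.2.1 < k w
    · simp only [if_pos hi]
      exact inv_degree_mul_sum_ports ports f w
    · simp only [if_neg hi]
      exact inv_mul_sum_port_one hn hdeg w
  simp_rw [h2]
  rw [prod_index t r (k w) fun _ => (transitionMatrix G).mulVec f w, ← Finset.prod_filter,
    Finset.prod_const, Fin.card_filter_val_lt, min_eq_right (hk w)]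

theorem walkCount_le (ω : Outcomes G n T) (r : Rank n) (u : V) {t : ℕ} (ht : t ≤ T + 1) (v : V) :
    walkCount ports ω r u t v ≤ n * numTokens n :=
  ((Finset.single_le_sum (f := walkCount ports ω r u t) (fun _ _ => Nat.zero_le _)
    (Finset.mem_univ v)).trans (sum_walkCount ports ω r u hn ht).le).trans
    (Nat.le_mul_of_pos_left _ hn)

theorem expect_prod_pow_walkCount (f : V → ℝ) (r : Rank n) (u : V) {t : ℕ} (ht : t ≤ T + 1) :
    expect (fun ω : Outcomes G n T => ∏ v, f v ^ walkCount ports ω r u t v) =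
      ((transitionMatrix G ^ t).mulVec f u) ^ numTokens n := by
  induction t generalizing f with
  | zero =>
    have : ∀ ω : Outcomes G n T, ∏ v, f v ^ walkCount ports ω r u 0 v = f u ^ numTokens n := by
      intro ω
      simp only [walkCount]
      rw [Finset.prod_eq_single u]
      · simp
      · intro v _ hv
        simp [hv]
      · simp
    simp_rw [this]
    rw [expect_const hn hdeg]
    simp
  | succ t ih =>
    have ht' : t < T + 1 := by omega
    have h1 : ∀ ω : Outcomes G n T, ∏ v, f v ^ walkCount ports ω r u (t + 1) v =
        ∏ w, ∏ j : Fin (n * numTokens n), if j.1 < walkCount ports ω r u t w then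
          f (ports w ((ω w).2.2 (⟨t, ht'⟩, r, j))) else 1 := by
      intro ω
      simp_rw [walkCount_succ ports ω r u ht', ← Finset.prod_pow_eq_pow_sum]
      rw [prod_reversePort ports fun v w x =>
        f v ^ sampleCount (ω w) ⟨t, ht'⟩ r (walkCount ports ω r u t w) x]
      exact Finset.prod_congr rfl fun w _ =>
        prod_pow_sampleCount (ω w) ⟨t, ht'⟩ r _ fun x => f (ports w x)
    simp_rw [h1]
    rw [expect_diag hn hdeg {i | i.1 = ⟨t, ht'⟩} fun ω ω' => ∏ w, ∏ j : Fin (n * numTokens n),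
      if j.1 < walkCount ports ω r u t w then
          f (ports w ((ω' w).2.2 (⟨t, ht'⟩, r, j))) else 1]
    · simp_rw [expect_prod_samples ports hn hdeg f ⟨t, ht'⟩ r _
        (walkCount_le ports hn hdeg _ r u ht'.le)]
      rw [ih ((transitionMatrix G).mulVec f) ht'.le, Matrix.mulVec_mulVec, ← pow_succ]
    · intro ω₁ ω₂ ω' h
      rw [walkCount_congr ports r u (ω := ω₁) (ω' := ω₂) fun v s hs j => (h v).2.2 (s, r, j)
        fun hmem => by
          have : s.1 = t := congrArg Fin.val (show s = ⟨t, ht'⟩ from hmem)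
          omega]
    · intro ω ω₁ ω₂ h
      refine Finset.prod_congr rfl fun w _ => Finset.prod_congr rfl fun j _ => ?_
      rw [h w (⟨t, ht'⟩, r, j) rfl]

/-! ### Walks of different ranks meet -/

/-- The walks avoid a set with exponentially small probability. -/
theorem expect_prod_zero_pow_le (r : Rank n) (u : V) {q : V → ℝ}
    (hq : ∀ w, q w ≤ (transitionMatrix G ^ (T + 1)) u w) (Z : Finset V) :
    expect (fun ω : Outcomes G n T => ∏ w ∈ Z, (0 : ℝ) ^ walkCount ports ω r u (T + 1) w) ≤
      ∏ w ∈ Z, Real.exp (-(numTokens n * q w)) := by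
  have h1 : ∀ ω : Outcomes G n T, ∏ w ∈ Z, (0 : ℝ) ^ walkCount ports ω r u (T + 1) w =
      ∏ w, (if w ∈ Z then (0 : ℝ) else 1) ^ walkCount ports ω r u (T + 1) w := by
    intro ω
    rw [← Finset.prod_subset (Finset.subset_univ Z)]
    · exact Finset.prod_congr rfl fun w hw => by rw [if_pos hw]
    · intro w _ hw
      simp [hw]
  simp_rw [h1]
  rw [expect_prod_pow_walkCount ports hn hdeg _ r u le_rfl, ← Real.exp_sum,
    Finset.sum_neg_distrib, ← Finset.mul_sum]
  have h2 : (transitionMatrix G ^ (T + 1)).mulVec (fun w => if w ∈ Z then (0 : ℝ) else 1) u =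
      1 - ∑ w ∈ Z, (transitionMatrix G ^ (T + 1)) u w := by
    rw [Matrix.mulVec, dotProduct, eq_sub_iff_add_eq]
    refine Eq.trans ?_ (transitionMatrix_pow_row_sum hdeg (T + 1) u)
    have : ∑ w ∈ Z, (transitionMatrix G ^ (T + 1)) u w =
        ∑ w, if w ∈ Z then (transitionMatrix G ^ (T + 1)) u w else 0 := by simp
    rw [this, ← Finset.sum_add_distrib]
    refine Finset.sum_congr rfl fun w _ => ?_
    split_ifs <;> simp
  have h3 : 0 ≤ 1 - ∑ w ∈ Z, (transitionMatrix G ^ (T + 1)) u w := by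
    rw [sub_nonneg, ← transitionMatrix_pow_row_sum hdeg (T + 1) u]
    exact Finset.sum_le_univ_sum_of_nonneg fun w => transitionMatrix_pow_nonneg _ _ _
  have h4 : ∑ w ∈ Z, q w ≤ ∑ w ∈ Z, (transitionMatrix G ^ (T + 1)) u w :=
    Finset.sum_le_sum fun w _ => hq w
  rw [h2, ← mul_neg, Real.exp_nat_mul]
  refine pow_le_pow_left₀ h3 ?_ _
  have := Real.add_one_le_exp (-∑ w ∈ Z, q w)
  linarith

/-- Probability that the undisturbed walks of two ranks end at different nodes. -/
theorem expect_disjoint_le {r r' : Rank n} (hr : r ≠ r') (u u' : V) {q : V → ℝ}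
    (hq0 : ∀ w, 0 ≤ q w) (hq : ∀ v w, q w ≤ (transitionMatrix G ^ (T + 1)) v w) :
    expect (fun ω : Outcomes G n T => ∏ w, if walkCount ports ω r u (T + 1) w ≠ 0 then
      (0 : ℝ) ^ walkCount ports ω r' u' (T + 1) w else 1) ≤
      ∏ w, (Real.exp (-(numTokens n * q w)) +
        (1 - Real.exp (-(numTokens n * q w))) * Real.exp (-(numTokens n * q w))) := by
  set e : V → ℝ := fun w => Real.exp (-(numTokens n * q w)) with he
  have he1 : ∀ w, e w ≤ 1 := fun w => Real.exp_le_one_iff.2 (by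
    have := hq0 w
    have : 0 ≤ (numTokens n : ℝ) * q w := by positivity
    linarith)
  have he0 : ∀ w, 0 ≤ e w := fun w => (Real.exp_pos _).le
  rw [expect_diag hn hdeg {i | i.2.1 = r'} fun ω ω' => ∏ w,
    if walkCount ports ω r u (T + 1) w ≠ 0 then
      (0 : ℝ) ^ walkCount ports ω' r' u' (T + 1) w else 1]
  · calc _ ≤ expect (fun ω : Outcomes G n T =>
          ∏ w, (e w + (1 - e w) * 0 ^ walkCount ports ω r u (T + 1) w)) := by
          refine expect_mono hn fun ω => ?_
          simp_rw [← Finset.prod_filter]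
          refine (expect_prod_zero_pow_le ports hn hdeg r' u' (hq u') _).trans_eq ?_
          rw [Finset.prod_filter]
          refine Finset.prod_congr rfl fun w _ => ?_
          by_cases h : walkCount ports ω r u (T + 1) w = 0 <;> simp [h, he]
      _ = ∑ S ∈ Finset.univ.powerset, ((∏ w ∈ S, e w) * ∏ w ∈ Finset.univ \ S, (1 - e w)) *
          expect (fun ω : Outcomes G n T =>
            ∏ w ∈ Finset.univ \ S, (0 : ℝ) ^ walkCount ports ω r u (T + 1) w) := by
          simp_rw [Finset.prod_add]
          rw [expect_sum]
          refine Finset.sum_congr rfl fun S _ => ?_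
          rw [← expect_mul_left]
          simp_rw [Finset.prod_mul_distrib, mul_assoc]
      _ ≤ ∑ S ∈ Finset.univ.powerset, ((∏ w ∈ S, e w) * ∏ w ∈ Finset.univ \ S, (1 - e w)) *
          ∏ w ∈ Finset.univ \ S, e w := by
          refine Finset.sum_le_sum fun S _ => mul_le_mul_of_nonneg_left
            (expect_prod_zero_pow_le ports hn hdeg r u (hq u) _) (mul_nonneg ?_ ?_)
          · exact Finset.prod_nonneg fun w _ => he0 w
          · exact Finset.prod_nonneg fun w _ => sub_nonneg.2 (he1 w)
      _ = _ := by
          rw [Finset.prod_add]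
          refine Finset.sum_congr rfl fun S _ => ?_
          rw [Finset.prod_mul_distrib, mul_assoc]
  · intro ω₁ ω₂ ω' h
    rw [walkCount_congr ports r u (ω := ω₁) (ω' := ω₂) fun v s _ j => (h v).2.2 (s, r, j) hr]
  · intro ω ω₁ ω₂ h
    rw [walkCount_congr ports r' u' (ω := ω₁) (ω' := ω₂) fun v s _ j => h v (s, r', j) rfl]

end GeneratingFunction

/-! ### Numerical estimates -/

section Numerical

theorem exp_neg_add_le {a l : ℝ} (ha : 0 ≤ a) (hl : l ≤ 1 / 2) :
    Real.exp (-a) + (1 - Real.exp (-a)) * Real.exp (-a) ≤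
      Real.exp (-((2 * l * a - l ^ 2) / 4)) := by
  rcases le_total a 1 with h | h
  · have h1 : Real.exp (-a) ≤ 1 - a / 2 := by
      have h2 : a + 1 ≤ Real.exp a := Real.add_one_le_exp a
      have h3 : Real.exp (-a) ≤ (a + 1)⁻¹ := by
        rw [Real.exp_neg]
        exact inv_anti₀ (by linarith) h2
      refine h3.trans ((inv_le_iff_one_le_mul₀ (by linarith)).2 ?_)
      nlinarith
    have h2 : Real.exp (-a) + (1 - Real.exp (-a)) * Real.exp (-a) ≤ 1 - a ^ 2 / 4 := by
      nlinarith [Real.exp_pos (-a)]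
    have h3 := Real.add_one_le_exp (-(a ^ 2 / 4))
    have h4 : Real.exp (-(a ^ 2 / 4)) ≤ Real.exp (-((2 * l * a - l ^ 2) / 4)) :=
      Real.exp_le_exp.2 (by nlinarith [sq_nonneg (a - l)])
    linarith
  · have h1 : Real.exp (-a) + (1 - Real.exp (-a)) * Real.exp (-a) ≤ 2 * Real.exp (-a) := by
      nlinarith [Real.exp_pos (-a)]
    have h2 : 2 * Real.exp (-a) ≤ Real.exp (-(a / 4)) := by
      have h3 : (2 : ℝ) ≤ Real.exp (3 / 4) := by
        rw [← Real.log_le_iff_le_exp (by norm_num)]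
        linarith [Real.log_two_lt_d9]
      calc 2 * Real.exp (-a) ≤ Real.exp (3 / 4) * Real.exp (-a) := by gcongr
        _ = Real.exp (3 / 4 - a) := by rw [← Real.exp_add]; ring_nf
        _ ≤ _ := Real.exp_le_exp.2 (by linarith)
    refine h1.trans (h2.trans (Real.exp_le_exp.2 ?_))
    nlinarith [sq_nonneg l]

theorem two_mul_sqrt_le_numTokens (n : ℕ) :
    2 * Real.sqrt (n * Real.log n) ≤ numTokens n := by
  unfold numTokens
  push_cast
  linarith [Nat.le_ceil (Real.sqrt (n * Real.log n))]

theorem prod_exp_le {ι : Type*} [Fintype ι] {n : ℕ} (hn : 0 < n) (hcard : Fintype.card ι = n)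
    (hlog : 4 * Real.log n ≤ n) {q : ι → ℝ} (hq0 : ∀ w, 0 ≤ q w) (hq : 1 / 2 ≤ ∑ w, q w) :
    ∏ w, (Real.exp (-(numTokens n * q w)) +
        (1 - Real.exp (-(numTokens n * q w))) * Real.exp (-(numTokens n * q w))) ≤
      (n : ℝ) ^ (-(1 / 4) : ℝ) := by
  have hn' : (0 : ℝ) < n := by exact_mod_cast hn
  have hL : 0 ≤ Real.log n := Real.log_natCast_nonneg n
  set l := Real.sqrt (Real.log n / n) with hl
  have hl0 : 0 ≤ l := Real.sqrt_nonneg _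
  have hl1 : l ≤ 1 / 2 := by
    rw [hl, Real.sqrt_le_left (by norm_num), div_le_iff₀ hn']
    linarith
  have hl2 : l ^ 2 = Real.log n / n := Real.sq_sqrt (by positivity)
  have hl3 : 2 * Real.log n ≤ l * numTokens n := by
    have h1 : l * Real.sqrt (n * Real.log n) = Real.log n := by
      rw [hl, ← Real.sqrt_mul (by positivity)]
      rw [show Real.log n / n * (n * Real.log n) = Real.log n ^ 2 by field_simp]
      exact Real.sqrt_sq hL
    nlinarith [mul_le_mul_of_nonneg_left (two_mul_sqrt_le_numTokens n) hl0]
  calc _ ≤ ∏ w, Real.exp (-((2 * l * (numTokens n * q w) - l ^ 2) / 4)) := by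
        refine Finset.prod_le_prod (fun w _ => ?_) fun w _ =>
          exp_neg_add_le (mul_nonneg (Nat.cast_nonneg _) (hq0 w)) hl1
        have h1 : Real.exp (-(numTokens n * q w)) ≤ 1 := Real.exp_le_one_iff.2
          (neg_nonpos.2 (mul_nonneg (Nat.cast_nonneg _) (hq0 w)))
        have h2 := Real.exp_pos (-(numTokens n * q w))
        nlinarith
    _ = Real.exp (-((2 * (l * numTokens n) * ∑ w, q w) - n * l ^ 2) / 4) := by
        rw [← Real.exp_sum]
        congr 1
        rw [Finset.sum_neg_distrib, ← Finset.sum_div, Finset.sum_sub_distrib, Finset.mul_sum,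
          neg_div]
        simp only [Finset.sum_const, Finset.card_univ, hcard, nsmul_eq_mul]
        congr 4
        funext w
        ring
    _ ≤ Real.exp (Real.log n * (-(1 / 4))) := by
        refine Real.exp_le_exp.2 ?_
        rw [hl2, mul_div_cancel₀ _ hn'.ne']
        nlinarith [mul_le_mul hl3 hq (by norm_num) (by positivity)]
    _ = _ := (Real.rpow_def_of_pos hn' _).symm

end Numerical

end Election

namespace Election

section Probability

variable {V : Type*} [Fintype V] [DecidableEq V] {G : SimpleGraph V} [DecidableRel G.Adj]
  (ports : PortNumbering G) {n T : ℕ}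

/-! ### Probability of a successful election -/

/-- Coins for which the election succeeds with few messages. -/
def goodSet (G : SimpleGraph V) [DecidableRel G.Adj] (ports : PortNumbering G) (n T : ℕ) :
    Set (Outcomes G n T) :=
  {ω | Good ports ω ∧ (numCandidates ω : ℝ) ≤ 8 * Real.log n}

theorem prod_ite_or {u v : V} (huv : u ≠ v) (a : ℝ) :
    ∏ x, (if x = u ∨ x = v then a else 1) = a ^ 2 := by
  rw [← Finset.prod_filter, Finset.prod_const]
  congr 1
  rw [show (Finset.univ.filter fun x => x = u ∨ x = v) = {u, v} by ext; simp]
  exact Finset.card_pair huv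

theorem prod_ite_or_apply {u v : V} (huv : u ≠ v) (a : V → ℝ) :
    ∏ x, (if x = u ∨ x = v then a x else 1) = a u * a v := by
  rw [← Finset.prod_filter,
    show (Finset.univ.filter fun x => x = u ∨ x = v) = {u, v} by ext; simp]
  exact Finset.prod_pair huv

/-- Product form of the event that the walks of `u` and `v` end at different nodes. -/
noncomputable def avoid (ω : Outcomes G n T) (r r' : Rank n) (u v : V) : ℝ :=
  ∏ w, if walkCount ports ω r u (T + 1) w ≠ 0 then
      (0 : ℝ) ^ walkCount ports ω r' v (T + 1) w else 1

theorem avoid_nonneg (ω : Outcomes G n T) (r r' : Rank n) (u v : V) :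
    0 ≤ avoid ports ω r r' u v :=
  Finset.prod_nonneg fun w _ => by split_ifs <;> positivity

variable (hn : 0 < n) (hdeg : ∀ v, 0 < G.degree v)

include hn hdeg

theorem expect_rank_eq {u v : V} (huv : u ≠ v) :
    expect (fun ω : Outcomes G n T => if (ω u).2.1 = (ω v).2.1 then (1 : ℝ) else 0) =
      ((n : ℝ) ^ 4)⁻¹ := by
  have h1 : ∀ ω : Outcomes G n T, (if (ω u).2.1 = (ω v).2.1 then (1 : ℝ) else 0) =
      ∑ r : Rank n, ∏ x, (1 * if x = u ∨ x = v then (if (ω x).2.1 = r then (1 : ℝ) else 0)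
        else 1) := by
    intro ω
    simp_rw [one_mul]
    simp_rw [prod_ite_or_apply huv]
    simp
  simp_rw [h1]
  rw [expect_sum]
  have h2 : ∀ r : Rank n, expect (fun ω : Outcomes G n T => ∏ x, (1 * if x = u ∨ x = v then
      (if (ω x).2.1 = r then (1 : ℝ) else 0) else 1)) = (((n : ℝ) ^ 4)⁻¹) ^ 2 := by
    intro r
    rw [expect_prod_basic hn hdeg (fun _ _ => 1) fun x k => if x = u ∨ x = v then
      (if k = r then (1 : ℝ) else 0) else 1, ← prod_ite_or huv]
    refine Finset.prod_congr rfl fun x _ => ?_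
    split_ifs
    · simp
    · rw [inv_mul_sum_rank_one hn]; ring
  simp_rw [h2]
  rw [Finset.sum_const, Finset.card_univ, card_rank, nsmul_eq_mul]
  have : (n : ℝ) ≠ 0 := by exact_mod_cast hn.ne'
  push_cast
  field_simp

theorem expect_cand_pair {u v : V} (huv : u ≠ v) :
    expect (fun ω : Outcomes G n T => if (ω u).1 = true ∧ (ω v).1 = true then (1 : ℝ) else 0) =
      candProb n ^ 2 := by
  have h1 : ∀ ω : Outcomes G n T, (if (ω u).1 = true ∧ (ω v).1 = true then (1 : ℝ) else 0) =
      ∏ x, if x = u ∨ x = v then (if (ω x).1 = true then (1 : ℝ) else 0) else 1 := by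
    intro ω
    rw [prod_ite_or_apply huv]
    by_cases h1 : (ω u).1 = true <;> by_cases h2 : (ω v).1 = true <;> simp [h1, h2]
  simp_rw [h1]
  rw [expect_prod_cand hn hdeg fun x b => if x = u ∨ x = v then
    (if b = true then (1 : ℝ) else 0) else 1, ← prod_ite_or huv]
  refine Finset.prod_congr rfl fun x _ => ?_
  by_cases h : x = u ∨ x = v
  · simp only [if_pos h]
    simp
  · simp only [if_neg h]
    ring

theorem expect_not_meet_le {u v : V} (huv : u ≠ v) {β : ℝ} (hβ0 : 0 ≤ β)
    (hβ : ∀ r r' : Rank n, r ≠ r' →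
      expect (fun ω : Outcomes G n T => avoid ports ω r r' u v) ≤ β) :
    expect (fun ω : Outcomes G n T => if (ω u).1 = true ∧ (ω v).1 = true ∧
        (ω u).2.1 ≠ (ω v).2.1 then avoid ports ω (ω u).2.1 (ω v).2.1 u v else 0) ≤
      candProb n ^ 2 * β := by
  rw [expect_diag hn hdeg Set.univ fun ω ω' => if (ω u).1 = true ∧ (ω v).1 = true ∧
        (ω u).2.1 ≠ (ω v).2.1 then avoid ports ω' (ω u).2.1 (ω v).2.1 u v else 0]
  · rw [← expect_cand_pair hn hdeg huv, mul_comm _ β, ← expect_mul_left]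
    refine expect_mono hn fun ω => ?_
    by_cases h1 : (ω u).1 = true ∧ (ω v).1 = true
    · by_cases h2 : (ω u).2.1 ≠ (ω v).2.1
      · simp only [h1, h2, and_self, if_true, ne_eq, not_false_eq_true, mul_one]
        exact hβ _ _ h2
      · simp only [h1, h2, and_self, if_true, mul_one, if_false, and_false]
        rw [expect_const hn hdeg]
        exact hβ0
    · have h2 : ¬ ((ω u).1 = true ∧ (ω v).1 = true ∧ (ω u).2.1 ≠ (ω v).2.1) :=
        fun h => h1 ⟨h.1, h.2.1⟩
      simp only [h1, h2, if_false, mul_zero]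
      rw [expect_const hn hdeg]
  · intro ω₁ ω₂ ω' h
    rw [(h u).1, (h v).1, (h u).2.1, (h v).2.1]
  · intro ω ω₁ ω₂ h
    unfold avoid
    rw [walkCount_congr ports _ u (ω := ω₁) (ω' := ω₂) fun x s _ j => h x _ (Set.mem_univ _),
      walkCount_congr ports _ v (ω := ω₁) (ω' := ω₂) fun x s _ j => h x _ (Set.mem_univ _)]

theorem expect_no_candidate_le (hcard : Fintype.card V = n) :
    expect (fun ω : Outcomes G n T => ∏ v, if (ω v).1 = true then (0 : ℝ) else 1) ≤
      ((n : ℝ) ^ 2)⁻¹ := by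
  have hn' : (0 : ℝ) < n := by exact_mod_cast hn
  rw [expect_prod_cand hn hdeg fun _ b => if b = true then (0 : ℝ) else 1]
  simp only [if_true, mul_zero, zero_add, Bool.false_eq_true, if_false, mul_one,
    Finset.prod_const, Finset.card_univ, hcard]
  calc (1 - candProb n) ^ n ≤ Real.exp (-candProb n) ^ n := by
        refine pow_le_pow_left₀ (by linarith [candProb_lt_one hn]) ?_ _
        linarith [Real.add_one_le_exp (-candProb n)]
    _ = Real.exp (-(2 * Real.log n)) := by
        rw [← Real.exp_nat_mul]
        congr 1
        unfold candProb
        field_simp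
    _ = ((n : ℝ) ^ 2)⁻¹ := by
        rw [Real.exp_neg, mul_comm, Real.exp_mul, Real.exp_log hn']
        norm_cast

theorem expect_two_pow_numCandidates_le (hcard : Fintype.card V = n) :
    expect (fun ω : Outcomes G n T => (2 : ℝ) ^ numCandidates ω) ≤ (n : ℝ) ^ 2 := by
  have hn' : (0 : ℝ) < n := by exact_mod_cast hn
  have h1 : ∀ ω : Outcomes G n T, (2 : ℝ) ^ numCandidates ω =
      ∏ v, if (ω v).1 = true then (2 : ℝ) else 1 := by
    intro ω
    rw [← Finset.prod_filter, Finset.prod_const, numCandidates]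
  simp_rw [h1]
  rw [expect_prod_cand hn hdeg fun _ b => if b = true then (2 : ℝ) else 1]
  simp only [if_true, Bool.false_eq_true, if_false, mul_one,
    Finset.prod_const, Finset.card_univ, hcard]
  calc (candProb n * 2 + (1 - candProb n)) ^ n ≤ Real.exp (candProb n) ^ n := by
        refine pow_le_pow_left₀ (by linarith [candProb_nonneg n]) ?_ _
        linarith [Real.add_one_le_exp (candProb n)]
    _ = Real.exp (2 * Real.log n) := by
        rw [← Real.exp_nat_mul]
        congr 1
        unfold candProb
        field_simp
    _ = (n : ℝ) ^ 2 := by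
        rw [mul_comm, Real.exp_mul, Real.exp_log hn']
        norm_cast

/-- Upper bound for the indicator of failure. -/
noncomputable def failure (ω : Outcomes G n T) : ℝ :=
  (∏ v, if (ω v).1 = true then (0 : ℝ) else 1) + ((n : ℝ) ^ 4)⁻¹ * 2 ^ numCandidates ω +
    ∑ p : V × V with p.1 ≠ p.2, (if (ω p.1).2.1 = (ω p.2).2.1 then (1 : ℝ) else 0) +
    ∑ p : V × V with p.1 ≠ p.2,
      (if (ω p.1).1 = true ∧ (ω p.2).1 = true ∧ (ω p.1).2.1 ≠ (ω p.2).2.1 then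
        avoid ports ω (ω p.1).2.1 (ω p.2).2.1 p.1 p.2 else 0)

theorem expect_failure_le (hcard : Fintype.card V = n) {β : ℝ} (hβ0 : 0 ≤ β)
    (hβ : ∀ u v (r r' : Rank n), r ≠ r' →
      expect (fun ω : Outcomes G n T => avoid ports ω r r' u v) ≤ β) :
    expect (fun ω : Outcomes G n T => failure ports ω) ≤
      3 * ((n : ℝ) ^ 2)⁻¹ + 4 * Real.log n ^ 2 * β := by
  have hn' : (0 : ℝ) < n := by exact_mod_cast hn
  have hPcard : ((Finset.univ.filter fun p : V × V => p.1 ≠ p.2).card : ℝ) ≤ (n : ℝ) ^ 2 := by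
    have : (Finset.univ.filter fun p : V × V => p.1 ≠ p.2).card ≤ n ^ 2 := by
      refine (Finset.card_le_univ _).trans ?_
      rw [Fintype.card_prod, hcard, sq]
    exact_mod_cast this
  have h1 := expect_no_candidate_le (T := T) hn hdeg hcard
  have h2 : ((n : ℝ) ^ 4)⁻¹ * expect (fun ω : Outcomes G n T => (2 : ℝ) ^ numCandidates ω) ≤
      ((n : ℝ) ^ 2)⁻¹ := by
    refine (mul_le_mul_of_nonneg_left (expect_two_pow_numCandidates_le hn hdeg hcard)
      (by positivity)).trans_eq ?_
    field_simp
  have h3 : ∑ p : V × V with p.1 ≠ p.2, expect (fun ω : Outcomes G n T =>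
      if (ω p.1).2.1 = (ω p.2).2.1 then (1 : ℝ) else 0) ≤ ((n : ℝ) ^ 2)⁻¹ := by
    calc _ = ∑ p : V × V with p.1 ≠ p.2, ((n : ℝ) ^ 4)⁻¹ := Finset.sum_congr rfl fun p hp =>
          expect_rank_eq (u := p.1) (v := p.2) hn hdeg (Finset.mem_filter.1 hp).2
      _ ≤ (n : ℝ) ^ 2 * ((n : ℝ) ^ 4)⁻¹ := by
          rw [Finset.sum_const, nsmul_eq_mul]
          exact mul_le_mul_of_nonneg_right hPcard (by positivity)
      _ = _ := by field_simp
  have h4 : ∑ p : V × V with p.1 ≠ p.2, expect (fun ω : Outcomes G n T =>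
      if (ω p.1).1 = true ∧ (ω p.2).1 = true ∧ (ω p.1).2.1 ≠ (ω p.2).2.1 then
        avoid ports ω (ω p.1).2.1 (ω p.2).2.1 p.1 p.2 else 0) ≤ 4 * Real.log n ^ 2 * β := by
    calc _ ≤ ∑ p : V × V with p.1 ≠ p.2, candProb n ^ 2 * β := Finset.sum_le_sum fun p hp =>
          expect_not_meet_le (u := p.1) (v := p.2) ports hn hdeg
            (Finset.mem_filter.1 hp).2 hβ0 (hβ p.1 p.2)
      _ ≤ (n : ℝ) ^ 2 * (candProb n ^ 2 * β) := by
          rw [Finset.sum_const, nsmul_eq_mul]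
          exact mul_le_mul_of_nonneg_right hPcard (by positivity)
      _ = _ := by
          unfold candProb
          field_simp
          ring
  unfold failure
  rw [expect_add, expect_add, expect_add, expect_mul_left, expect_sum, expect_sum]
  linarith

theorem one_le_failure_add_indicator (ω : Outcomes G n T) :
    1 ≤ failure ports ω + (goodSet G ports n T).indicator (fun _ => 1) ω := by
  have hn' : (0 : ℝ) < n := by exact_mod_cast hn
  have hL := Real.log_natCast_nonneg n
  have t1 : 0 ≤ ∏ v, if (ω v).1 = true then (0 : ℝ) else 1 :=
    Finset.prod_nonneg fun _ _ => by split_ifs <;> norm_num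
  have t2 : 0 ≤ ((n : ℝ) ^ 4)⁻¹ * 2 ^ numCandidates ω := by positivity
  have t3' : ∀ p ∈ Finset.univ.filter fun p : V × V => p.1 ≠ p.2,
      (0 : ℝ) ≤ if (ω p.1).2.1 = (ω p.2).2.1 then (1 : ℝ) else 0 :=
    fun _ _ => by split_ifs <;> norm_num
  have t3 := Finset.sum_nonneg t3'
  have t4' : ∀ p ∈ Finset.univ.filter fun p : V × V => p.1 ≠ p.2,
      0 ≤ if (ω p.1).1 = true ∧ (ω p.2).1 = true ∧ (ω p.1).2.1 ≠ (ω p.2).2.1 then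
        avoid ports ω (ω p.1).2.1 (ω p.2).2.1 p.1 p.2 else 0 := fun _ _ => by
    split_ifs
    · exact avoid_nonneg ports _ _ _ _ _
    · exact le_rfl
  have t4 := Finset.sum_nonneg t4'
  by_cases hω : ω ∈ goodSet G ports n T
  · rw [Set.indicator_of_mem hω, failure]
    linarith
  rw [Set.indicator_of_notMem hω, add_zero]
  by_contra hlt
  rw [not_le, failure] at hlt
  have hsame : ∀ u v, u ≠ v → (ω u).2.1 ≠ (ω v).2.1 := by
    intro u v huv hr
    have := Finset.single_le_sum t3' (show (u, v) ∈ _ by simpa using huv)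
    simp only [hr, if_true] at this
    linarith
  refine hω ⟨⟨?_, ?_, ?_⟩, ?_⟩
  · by_contra hno
    push Not at hno
    have : ∏ v, (if (ω v).1 = true then (0 : ℝ) else 1) = 1 :=
      Finset.prod_eq_one fun v _ => by simp [hno v]
    linarith
  · intro u v _ _ hr
    by_contra huv
    exact hsame u v huv hr
  · intro u v hu hv huv
    by_contra hno
    push Not at hno
    have hr := hsame u v huv
    have := Finset.single_le_sum t4' (show (u, v) ∈ _ by simpa using huv)
    have hav : avoid ports ω (ω u).2.1 (ω v).2.1 u v = 1 := by
      refine Finset.prod_eq_one fun w _ => ?_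
      split_ifs with h0
      · rw [Nat.le_zero.1 (hno w (Nat.pos_of_ne_zero h0)), pow_zero]
      · rfl
    rw [if_pos ⟨hu, hv, hr⟩, hav] at this
    linarith
  · by_contra hmany
    rw [not_le] at hmany
    have h1 : (n : ℝ) ^ 4 ≤ 2 ^ numCandidates ω := by
      rw [← Real.rpow_natCast, ← Real.rpow_natCast, Real.rpow_def_of_pos hn',
        Real.rpow_def_of_pos two_pos]
      refine Real.exp_le_exp.2 ?_
      have := Real.log_two_gt_d9
      push_cast
      nlinarith
    have h2 : 1 ≤ ((n : ℝ) ^ 4)⁻¹ * 2 ^ numCandidates ω := by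
      rw [← inv_mul_cancel₀ (show (n : ℝ) ^ 4 ≠ 0 by positivity)]
      exact mul_le_mul_of_nonneg_left h1 (by positivity)
    linarith

theorem expect_goodSet_ge (hcard : Fintype.card V = n) {β : ℝ} (hβ0 : 0 ≤ β)
    (hβ : ∀ u v (r r' : Rank n), r ≠ r' →
      expect (fun ω : Outcomes G n T => avoid ports ω r r' u v) ≤ β) :
    1 - (3 * ((n : ℝ) ^ 2)⁻¹ + 4 * Real.log n ^ 2 * β) ≤
      expect ((goodSet G ports n T).indicator fun _ => 1) := by
  have h := expect_mono hn (one_le_failure_add_indicator (T := T) ports hn hdeg)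
  rw [expect_const hn hdeg, expect_add] at h
  linarith [expect_failure_le ports hn hdeg hcard hβ0 hβ]

theorem expect_goodSet_ge_of_single (hcard : Fintype.card V = n) (hlog : 1 ≤ Real.log n) :
    candProb n * (1 - candProb n) ^ (n - 1) ≤
      expect ((goodSet G ports n T).indicator fun _ => 1) := by
  have : Nonempty V := Fintype.card_pos_iff.1 (hcard ▸ hn)
  obtain ⟨u⟩ := this
  have h1 := expect_prod_cand (T := T) hn hdeg fun (v : V) b =>
    if v = u then (if b = true then (1 : ℝ) else 0) else if b = true then 0 else 1
  have h2 : ∏ v, (candProb n * (if v = u then (if true = true then (1 : ℝ) else 0)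
        else if true = true then 0 else 1) + (1 - candProb n) *
        (if v = u then (if false = true then (1 : ℝ) else 0)
        else if false = true then 0 else 1)) = candProb n * (1 - candProb n) ^ (n - 1) := by
    rw [← Finset.mul_prod_erase _ _ (Finset.mem_univ u)]
    congr 1
    · simp
    · rw [Finset.prod_congr rfl (g := fun _ => 1 - candProb n), Finset.prod_const,
        Finset.card_erase_of_mem (Finset.mem_univ u), Finset.card_univ, hcard]
      intro v hv
      simp [Finset.ne_of_mem_erase hv]
  rw [← h2, ← h1]
  refine expect_mono hn fun ω => ?_
  have hnn : (0 : ℝ) ≤ (goodSet G ports n T).indicator (fun _ => 1) ω :=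
    Set.indicator_nonneg (fun _ _ => zero_le_one) ω
  by_cases hω : ∀ v, (ω v).1 = true ↔ v = u
  · have hmem : ω ∈ goodSet G ports n T := by
      refine ⟨⟨⟨u, (hω u).2 rfl⟩, fun x y hx hy _ => ?_, fun x y hx hy hxy => ?_⟩, ?_⟩
      · rw [(hω x).1 hx, (hω y).1 hy]
      · exact absurd (((hω x).1 hx).trans ((hω y).1 hy).symm) hxy
      · have : numCandidates ω = 1 := by
          rw [numCandidates, Finset.card_eq_one]
          exact ⟨u, by ext v; simp [hω v]⟩
        rw [this]
        push_cast
        linarith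
    rw [Set.indicator_of_mem hmem]
    refine Finset.prod_le_one (fun v _ => ?_) fun v _ => ?_ <;> split_ifs <;> norm_num
  · push Not at hω
    obtain ⟨v, hv⟩ := hω
    rw [Finset.prod_eq_zero (Finset.mem_univ v)]
    · exact hnn
    · rcases hv with ⟨h, h'⟩ | ⟨h, h'⟩
      · simp [h, h']
      · simp [h, h']

end Probability

end Election

namespace Election

section Bounds

theorem one_lt_log_of_three_le {n : ℕ} (hn : 3 ≤ n) : 1 < Real.log n := by
  rw [Real.lt_log_iff_exp_lt (by positivity)]
  have : (3 : ℝ) ≤ n := by exact_mod_cast hn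
  linarith [Real.exp_one_lt_d9]

theorem numTokens_le {n : ℕ} (hn : 3 ≤ n) :
    (numTokens n : ℝ) ≤ 4 * Real.sqrt (n * Real.log n) := by
  have hL := one_lt_log_of_three_le hn
  have hn' : (3 : ℝ) ≤ n := by exact_mod_cast hn
  have h1 : 1 ≤ Real.sqrt (n * Real.log n) := by
    rw [Real.one_le_sqrt]
    nlinarith
  have h2 := Nat.ceil_lt_add_one (Real.sqrt_nonneg (n * Real.log n))
  unfold numTokens
  push_cast
  linarith

theorem numTokens_le_two_mul (n : ℕ) : numTokens n ≤ 2 * n := by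
  unfold numTokens
  refine Nat.mul_le_mul_left 2 (Nat.ceil_le.2 ?_)
  rw [Real.sqrt_le_left (by positivity), sq]
  exact mul_le_mul_of_nonneg_left (Real.log_le_self (by positivity)) (by positivity)

/-- Length of the binary encoding of a message with small entries. -/
theorem length_bits_le {n : ℕ} (hn : 3 ≤ n) {r : Rank n} {k m : ℕ}
    (hk : k ≤ n * numTokens n) (hm : m ≤ 2 * Nat.pair r.1 k + 1) :
    ((Nat.bits m).length : ℝ) ≤ 128 * Real.log n := by
  have hL := one_lt_log_of_three_le hn
  have hk' : k ≤ n ^ 4 := by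
    calc k ≤ n * (2 * n) := hk.trans (Nat.mul_le_mul_left n (numTokens_le_two_mul n))
      _ ≤ n * (n * n) := by gcongr; omega
      _ = n ^ 3 := by ring
      _ ≤ n ^ 4 := Nat.pow_le_pow_right (by omega) (by norm_num)
  have h1 : Nat.pair r.1 k < n ^ 10 := by
    calc Nat.pair r.1 k < (max r.1 k + 1) ^ 2 := Nat.pair_lt_max_add_one_sq _ _
      _ ≤ (n ^ 4 + 1) ^ 2 := by
          gcongr
          exact max_le r.2.2 hk'
      _ ≤ (n ^ 4 * n) ^ 2 := by
          gcongr
          have : 1 ≤ n ^ 4 := Nat.one_le_pow _ _ (by omega)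
          nlinarith
      _ = n ^ 10 := by ring
  have h2 : m < n ^ 11 := by
    calc m < 2 * n ^ 10 := by omega
      _ ≤ n * n ^ 10 := by gcongr; omega
      _ = n ^ 11 := by ring
  rw [Nat.size_eq_bits_len]
  rcases Nat.eq_zero_or_pos m.size with h0 | h0
  · rw [h0]
    push_cast
    linarith
  · have h3 : 2 ^ (m.size - 1) ≤ m := Nat.lt_size.1 (by omega)
    have h4 : (2 : ℝ) ^ (m.size - 1) ≤ (n : ℝ) ^ 11 := by exact_mod_cast h3.trans h2.le
    have h5 := Real.log_le_log (by positivity) h4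
    rw [Real.log_pow, Real.log_pow, Nat.cast_sub (by omega)] at h5
    push_cast at h5
    have h6 := Real.log_two_gt_d9
    have h7 : (1 : ℝ) ≤ m.size := by exact_mod_cast h0
    nlinarith

/-- A common exponent for an estimate that holds with exponent `1 / 8` from some point on and with
some exponent for every single number. -/
theorem exists_exponent (s : ℕ → ℝ) (hs : ∀ n, 3 ≤ n → 0 < s n) (N : ℕ) :
    ∃ c : ℝ, 0 < c ∧ c ≤ 1 / 8 ∧ ∀ n, 3 ≤ n → n < N → 1 - s n ≤ (n : ℝ) ^ (-c) := by
  have h1 : ∀ n ∈ Finset.Ico 3 N, ∀ᶠ c in nhdsWithin (0 : ℝ) (Set.Ioi 0),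
      1 - s n ≤ (n : ℝ) ^ (-c) := by
    intro n hn
    have h3 := (Finset.mem_Ico.1 hn).1
    have hn0 : (n : ℝ) ≠ 0 := by positivity
    have hcont : Filter.Tendsto (fun c : ℝ => (n : ℝ) ^ (-c)) (nhds 0) (nhds 1) := by
      have : Continuous fun c : ℝ => (n : ℝ) ^ (-c) :=
        continuous_const.rpow continuous_neg fun _ => Or.inl hn0
      simpa using this.tendsto 0
    have := hcont.eventually (eventually_ge_nhds (show 1 - s n < 1 by linarith [hs n h3]))
    exact this.filter_mono nhdsWithin_le_nhds
  have h2 := (Filter.eventually_all_finset _).2 h1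
  have h3 : ∀ᶠ c in nhdsWithin (0 : ℝ) (Set.Ioi 0), c ∈ Set.Ioc (0 : ℝ) (1 / 8) :=
    Ioc_mem_nhdsGT (by norm_num)
  obtain ⟨c, hc, hc'⟩ := (h2.and h3).exists
  exact ⟨c, hc'.1, hc'.2, fun n h3 hN => hc n (Finset.mem_Ico.2 ⟨h3, hN⟩)⟩

theorem eventually_failure_le : ∀ᶠ n : ℕ in Filter.atTop,
    4 * Real.log n ≤ n ∧
    3 * ((n : ℝ) ^ 2)⁻¹ + 4 * Real.log n ^ 2 * (n : ℝ) ^ (-(1 / 4) : ℝ) ≤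
      (n : ℝ) ^ (-(1 / 8) : ℝ) := by
  have h1 := (isLittleO_log_rpow_rpow_atTop (2 : ℝ) (show (0 : ℝ) < 1 / 8 by norm_num)).bound
    (show (0 : ℝ) < 1 / 8 by norm_num)
  have h2 := Real.isLittleO_log_id_atTop.bound (show (0 : ℝ) < 1 / 4 by norm_num)
  have h3 := (tendsto_rpow_neg_atTop (show (0 : ℝ) < 15 / 8 by norm_num)).eventually
    (eventually_le_nhds (show (0 : ℝ) < 1 / 6 by norm_num))
  refine tendsto_natCast_atTop_atTop.eventually (p := fun x : ℝ => 4 * Real.log x ≤ x ∧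
    3 * (x ^ 2)⁻¹ + 4 * Real.log x ^ 2 * x ^ (-(1 / 4) : ℝ) ≤ x ^ (-(1 / 8) : ℝ)) ?_
  filter_upwards [h1, h2, h3, Filter.eventually_ge_atTop 1] with x h1 h2 h3 hx
  have hx0 : 0 < x := by linarith
  have hL := Real.log_nonneg hx
  rw [Real.rpow_two, Real.norm_of_nonneg (by positivity), Real.norm_of_nonneg (by positivity)] at h1
  rw [Real.norm_of_nonneg hL, id, Real.norm_of_nonneg hx0.le] at h2
  refine ⟨by linarith, ?_⟩
  have e1 : (x ^ 2)⁻¹ = x ^ (-(15 / 8) : ℝ) * x ^ (-(1 / 8) : ℝ) := by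
    rw [← Real.rpow_add hx0, ← Real.rpow_two, ← Real.rpow_neg hx0.le]
    norm_num
  have e2 : x ^ (1 / 8 : ℝ) * x ^ (-(1 / 4) : ℝ) = x ^ (-(1 / 8) : ℝ) := by
    rw [← Real.rpow_add hx0]
    norm_num
  have hp : 0 < x ^ (-(1 / 8) : ℝ) := Real.rpow_pos_of_pos hx0 _
  have hp' : 0 < x ^ (-(1 / 4) : ℝ) := Real.rpow_pos_of_pos hx0 _
  have f1 := mul_le_mul_of_nonneg_right h3 hp.le
  have f2 := mul_le_mul_of_nonneg_right h1 hp'.le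
  rw [mul_assoc, e2] at f2
  rw [e1]
  linarith

end Bounds

section Main

variable {V : Type*} [Fintype V] [DecidableEq V] {G : SimpleGraph V} [DecidableRel G.Adj]
  (ports : PortNumbering G)

theorem expect_avoid_le (hc : G.Connected) (hb : ¬ G.IsBipartite) {n : ℕ}
    (hcard : Fintype.card V = n) (hlog : 4 * Real.log n ≤ n) (u v : V)
    {r r' : Rank n} (hr : r ≠ r') :
    expect (fun ω : Outcomes G n (mixingTime G) => avoid ports ω r r' u v) ≤
      (n : ℝ) ^ (-(1 / 4) : ℝ) := by
  have hdeg := hc.degree_pos_of_not_isBipartite hb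
  have := hc.nonempty
  have hn : 0 < n := hcard ▸ Fintype.card_pos
  have hn' : (0 : ℝ) < n := by exact_mod_cast hn
  set q : V → ℝ := fun w => max (stationary G w - 1 / (2 * n)) 0 with hq
  have hq0 : ∀ w, 0 ≤ q w := fun w => le_max_right _ _
  have hqle : ∀ x w, q w ≤ (transitionMatrix G ^ (mixingTime G + 1)) x w := by
    intro x w
    refine max_le ?_ (transitionMatrix_pow_nonneg _ _ _)
    have h := abs_transitionMatrix_pow_sub_stationary_le hc hb x w
    rw [hcard] at h
    linarith [(abs_le.1 h).1]
  have hsum : 1 / 2 ≤ ∑ w, q w := by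
    calc (1 : ℝ) / 2 = ∑ w, (stationary G w - 1 / (2 * n)) := by
          rw [Finset.sum_sub_distrib, sum_stationary hdeg, Finset.sum_const, Finset.card_univ,
            hcard, nsmul_eq_mul]
          field_simp
          norm_num
      _ ≤ _ := Finset.sum_le_sum fun w _ => le_max_left _ _
  exact (expect_disjoint_le ports hn hdeg hr u v hq0 hqle).trans
    (prod_exp_le hn hcard hlog hq0 hsum)

theorem goodSet_subset (hc : G.Connected) (hb : ¬ G.IsBipartite) (pick : PortChoice)
    {ω : Outcomes G (Fintype.card V) (mixingTime G)}
    (hω : ω ∈ goodSet G ports (Fintype.card V) (mixingTime G)) :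
    (∀ t : ℕ, 128 * (mixingTime G : ℝ) ≤ t → (algorithmOn G pick).LeaderAt ports ω t) ∧
      ∀ t : ℕ, ((algorithmOn G pick).messages ports ω t : ℝ) ≤
        128 * (mixingTime G * Real.sqrt (Fintype.card V) *
          Real.log (Fintype.card V) ^ (3 / 2 : ℝ)) := by
  have h3 := SimpleGraph.three_le_card_of_not_isBipartite hb
  have hT : (1 : ℝ) ≤ mixingTime G := by exact_mod_cast mixingTime_pos hc hb
  refine ⟨fun t ht => ?_, fun t => ?_⟩
  · refine hω.1.leaderAt ports pick (by omega) ?_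
    have : (2 * (mixingTime G + 1) : ℝ) ≤ t := by linarith
    exact_mod_cast this
  · have hL := one_lt_log_of_three_le h3
    have h1 : ((algorithmOn G pick).messages ports ω t : ℝ) ≤
        2 * (mixingTime G + 1) * (numCandidates ω * numTokens (Fintype.card V)) := by
      exact_mod_cast messages_le ports pick ω t
    have h2 : Real.sqrt (Fintype.card V * Real.log (Fintype.card V)) =
        Real.sqrt (Fintype.card V) * Real.sqrt (Real.log (Fintype.card V)) :=
      Real.sqrt_mul (by positivity) _
    have h4 : Real.log (Fintype.card V) ^ (3 / 2 : ℝ) =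
        Real.log (Fintype.card V) * Real.sqrt (Real.log (Fintype.card V)) := by
      rw [Real.sqrt_eq_rpow, ← Real.rpow_one_add' (by linarith) (by norm_num)]
      norm_num
    calc ((algorithmOn G pick).messages ports ω t : ℝ)
        ≤ 2 * (mixingTime G + 1) * (numCandidates ω * numTokens (Fintype.card V)) := h1
      _ ≤ (4 * mixingTime G) * ((8 * Real.log (Fintype.card V)) *
            (4 * (Real.sqrt (Fintype.card V) * Real.sqrt (Real.log (Fintype.card V))))) := by
          rw [← h2]
          exact mul_le_mul (by linarith) (mul_le_mul hω.2 (numTokens_le h3) (by positivity)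
            (by linarith)) (by positivity) (by linarith)
      _ = _ := by rw [h4]; ring

theorem messageSizeLE (hb : ¬ G.IsBipartite) (pick : PortChoice) :
    (algorithmOn G pick).MessageSizeLE ports (128 * Real.log (Fintype.card V)) := by
  intro ω t v x m hm
  obtain ⟨r, k, hk, hcode⟩ := code_sent_le ports pick ω rfl hm
  exact length_bits_le (SimpleGraph.three_le_card_of_not_isBipartite hb) hk hcode

theorem haltsWithin (hc : G.Connected) (hb : ¬ G.IsBipartite) (pick : PortChoice) :
    (algorithmOn G pick).HaltsWithin ports (128 * mixingTime G) := by
  intro ω t ht v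
  have hT : (1 : ℝ) ≤ mixingTime G := by exact_mod_cast mixingTime_pos hc hb
  have ht' : 2 * (mixingTime G + 1) ≤ t := by
    have : (2 * (mixingTime G + 1) : ℝ) ≤ t := by linarith
    exact_mod_cast this
  refine ⟨fun x => sent_eq_none ports pick ω ht' v x, ?_⟩
  exact congrArg State.status ((stateAt_of_two_mul_le ports pick ω (by omega) v).trans
    (stateAt_of_two_mul_le ports pick ω ht' v).symm)

end Main

end Election

theorem theorem2 :
    ∃ c : ℝ, 0 < c ∧ ∃ K : ℝ,
      ∀ (V : Type*) [Fintype V] [DecidableEq V] (G : SimpleGraph V) [DecidableRel G.Adj]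
        (ports : PortNumbering G) (pick : Election.PortChoice),
        G.Connected → ¬ G.IsBipartite →
        (Election.algorithmOn G pick).MessageSizeLE ports (K * Real.log (Fintype.card V)) ∧
        (Election.algorithmOn G pick).HaltsWithin ports (K * mixingTime G) ∧
        1 - (Fintype.card V : ℝ) ^ (-c) ≤
          ((Election.algorithmOn G pick).prob G).real {ω |
            (∀ t : ℕ, K * (mixingTime G : ℝ) ≤ t →
              (Election.algorithmOn G pick).LeaderAt ports ω t) ∧
            (∀ t : ℕ, ((Election.algorithmOn G pick).messages ports ω t : ℝ) ≤
              K * (mixingTime G * Real.sqrt (Fintype.card V) *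
                Real.log (Fintype.card V) ^ (3 / 2 : ℝ)))} := by
  obtain ⟨N, hN⟩ := Filter.eventually_atTop.1 Election.eventually_failure_le
  obtain ⟨c, hc0, hc8, hsmall⟩ := Election.exists_exponent
    (fun n => Election.candProb n * (1 - Election.candProb n) ^ (n - 1)) (fun n hn => by
      have h1 := Election.candProb_lt_one (show 0 < n by omega)
      have h2 := Election.one_lt_log_of_three_le hn
      have h3 : 0 < Election.candProb n := by unfold Election.candProb; positivity
      exact mul_pos h3 (pow_pos (by linarith) _)) N
  refine ⟨c, hc0, 128, fun V _ _ G _ ports pick hconn hb => ?_⟩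
  refine ⟨Election.messageSizeLE ports hb pick, Election.haltsWithin ports hconn hb pick, ?_⟩
  have h3 := SimpleGraph.three_le_card_of_not_isBipartite hb
  have hdeg := hconn.degree_pos_of_not_isBipartite hb
  have hn : 0 < Fintype.card V := by omega
  have hn1 : (1 : ℝ) ≤ Fintype.card V := by exact_mod_cast hn
  have hgood : 1 - (Fintype.card V : ℝ) ^ (-c) ≤ Election.expect
      ((Election.goodSet G ports (Fintype.card V) (mixingTime G)).indicator fun _ => 1) := by
    by_cases hlt : Fintype.card V < N
    · have h1 := Election.expect_goodSet_ge_of_single (T := mixingTime G) ports hn hdeg rfl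
        (Election.one_lt_log_of_three_le h3).le
      linarith [hsmall _ h3 hlt]
    · obtain ⟨hlog, hfail⟩ := hN _ (not_lt.1 hlt)
      have h1 := Election.expect_goodSet_ge (T := mixingTime G) ports hn hdeg rfl
        (Real.rpow_nonneg (Nat.cast_nonneg _) _) fun u v r r' hr =>
          Election.expect_avoid_le ports hconn hb rfl hlog u v hr
      have h2 : (Fintype.card V : ℝ) ^ (-(1 / 8) : ℝ) ≤ (Fintype.card V : ℝ) ^ (-c) :=
        Real.rpow_le_rpow_of_exponent_le hn1 (by linarith)
      linarith
  refine hgood.trans ?_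
  refine le_of_le_of_eq ?_
    (Election.prob_real_eq_expect (T := mixingTime G) hn hdeg pick _).symm
  refine Election.expect_mono hn fun ω => ?_
  refine Set.indicator_le_indicator_of_subset ?_ (fun _ => zero_le_one) ω
  exact fun ω' hω' => Election.goodSet_subset ports hconn hb pick hω'
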